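/- Below, a binary CSS code of length $N$ is given by two commuting sets of stabilizer generators, $X(g)$ for $g$ in a first list of vectors of $GF(2)^N$ and $Z(h)$ for $h$ in a second list, where $X(u)|a\rangle=|a+u\rangle$ and $Z(v)|a\rangle=(-1)^{v\cdot a}|a\rangle$ on $\mathbb C^{2^N}$. It is an $[[N,k,d_Z/d_X]]$ code if the common fixed space of the generators has dimension $2^k$, and $d_Z$ (resp. $d_X$) is the least weight of a $Z(v)$ (resp. $X(u)$) that commutes with all generators but is not in the stabilizer group. The syndrome has one bit per generator, which tells whether the error anticommutes with it. A decoder maps the syndrome to a correction $X(u')Z(v')$; the error $X(u)Z(v)$ is corrected if applying the correction restores every code state up to a global phase. Decoders are bit-level programs (for each code its own): in each time step every processor applies one Boolean operation to two bits of a common memory (which initially holds the syndrome) and stores the result in a new cell; the sequential case is that of one processor. There are lengths $N_0<N_1<\dots$, with $N_0\ge 2$, constants $\delta,C>0$, and, for every $N$ in this sequence, a binary CSS code $\mathscr Q$ with at most $N$ generators and parameters $$[[N,\ k\ge \delta N/\log N,\ d_Z\ge \delta N/\log N\,/\,d_X\ge \delta\log N]],$$ which has - a sequential decoder that runs in at most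 $CN$ time steps, and - a parallel decoder that runs in at most $C\log N$ time steps on at most $CN$ processors, each of which has the following two properties. 1. It corrects every $Z$-error of weight at most $\delta N/\log N$ (an almost linear number of $Z$-errors). 2. It corrects a linear number of random $X$-errors with high probability: if every qubit independently suffers an $X$-error with probability $p$ (so that $pN$ errors are expected), then for all constants $c>0$ and $0\le p<1/4^{c+1}$ the probability $\mathcal P$ that the $X$-error is not corrected, alone or together with some $Z$-error of weight at most $\delta N/\log N$, satisfies $N^{c}\,\mathcal P\to 0$ as $N\to\infty$ along the sequence. -/

import Mathlib

open Filter Topology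
open scoped Matrix

/-- A vector of `N` bits, i.e. an element of `GF(2)^N`. -/
abbrev Bits (N : ℕ) : Type := Fin N → ZMod 2

/-- The state space `ℂ^(2^N)` of `N` qubits: a vector is given by its amplitudes in the
computational basis `|a⟩`, `a ∈ GF(2)^N`. -/
abbrev QState (N : ℕ) : Type := Bits N → ℂ

/-- The operator `X(u)`, defined by `X(u)|a⟩ = |a + u⟩`. -/
def pauliX {N : ℕ} (u : Bits N) : QState N →ₗ[ℂ] QState N where
  toFun ψ := fun a => ψ (a - u)
  map_add' _ _ := rfl
  map_smul' _ _ := rfl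

/-- The operator `Z(v)`, defined by `Z(v)|a⟩ = (-1)^(v·a)|a⟩`. -/
def pauliZ {N : ℕ} (v : Bits N) : QState N →ₗ[ℂ] QState N where
  toFun ψ := fun a => (-1 : ℂ) ^ (v ⬝ᵥ a).val * ψ a
  map_add' ψ φ := by
    funext a
    exact mul_add _ _ _
  map_smul' z ψ := by
    funext a
    exact mul_left_comm _ _ _

/-- A binary CSS stabilizer code of length `N`, given by its stabilizer generators:
`X(g)` for the rows `g` of `xStab` and `Z(h)` for the rows `h` of `zStab`.
The generators commute; they are not required to be independent. -/
structure CSSCode (N : ℕ) where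
  /-- number of generators of type `X` -/
  rX : ℕ
  /-- number of generators of type `Z` -/
  rZ : ℕ
  xStab : Matrix (Fin rX) (Fin N) (ZMod 2)
  zStab : Matrix (Fin rZ) (Fin N) (ZMod 2)
  comm : xStab * zStabᵀ = 0

namespace CSSCode

variable {N : ℕ}

/-- The quantum code itself: the states that are fixed by every stabilizer generator. -/
def codeSpace (Q : CSSCode N) : Submodule ℂ (QState N) where
  carrier := {ψ | (∀ i, pauliX (Q.xStab i) ψ = ψ) ∧ (∀ j, pauliZ (Q.zStab j) ψ = ψ)}
  add_mem' := by
    intro a b ha hb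
    exact ⟨fun i => by rw [map_add, ha.1 i, hb.1 i], fun j => by rw [map_add, ha.2 j, hb.2 j]⟩
  zero_mem' := ⟨fun i => map_zero _, fun j => map_zero _⟩
  smul_mem' := by
    intro c a ha
    exact ⟨fun i => by rw [map_smul, ha.1 i], fun j => by rw [map_smul, ha.2 j]⟩

/-- The `Z`-distance: the least weight of a `Z(v)` that commutes with all generators
but is not in the stabilizer group. -/
noncomputable def distZ (Q : CSSCode N) : ℕ :=
  sInf {w | ∃ v : Bits N, Q.xStab *ᵥ v = 0 ∧
    v ∉ Submodule.span (ZMod 2) (Set.range Q.zStab) ∧ hammingNorm v = w}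

/-- The `X`-distance: the least weight of an `X(u)` that commutes with all generators
but is not in the stabilizer group. -/
noncomputable def distX (Q : CSSCode N) : ℕ :=
  sInf {w | ∃ u : Bits N, Q.zStab *ᵥ u = 0 ∧
    u ∉ Submodule.span (ZMod 2) (Set.range Q.xStab) ∧ hammingNorm u = w}

/-- A syndrome: one bit for every stabilizer generator. -/
abbrev Syndrome (Q : CSSCode N) : Type := Fin Q.rX ⊕ Fin Q.rZ → ZMod 2

/-- The syndrome of the error `X(u)Z(v)`: the bit of a generator is `1` if and only if the error
anticommutes with it. -/
def syndrome (Q : CSSCode N) (u v : Bits N) : Q.Syndrome :=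
  Sum.elim (Q.xStab *ᵥ v) (Q.zStab *ᵥ u)

/-- The decoder `D` maps a syndrome to a correction `X(u')Z(v')` (the bits `Sum.inl j` of its output
form `u'`, the bits `Sum.inr j` form `v'`). It corrects the error `X(u)Z(v)` if applying
the correction belonging to the syndrome of the error restores every code state,
up to a global phase. -/
def Corrects (Q : CSSCode N) (D : Q.Syndrome → (Fin N ⊕ Fin N → ZMod 2)) (u v : Bits N) : Prop :=
  ∃ ζ : ℂ, ‖ζ‖ = 1 ∧ ∀ ψ ∈ Q.codeSpace,
    pauliX (fun j => D (Q.syndrome u v) (Sum.inl j))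
      (pauliZ (fun j => D (Q.syndrome u v) (Sum.inr j)) (pauliX u (pauliZ v ψ))) = ζ • ψ

end CSSCode

/-- The probability that the random vector `u ∈ GF(2)^N`, whose coordinates are independent and
equal to `1` with probability `p`, lies in `S`. -/
noncomputable def bernoulliProb {N : ℕ} (p : ℝ) (S : Set (Bits N)) : ℝ :=
  ∑ u : Bits N, S.indicator (fun u => p ^ hammingNorm u * (1 - p) ^ (N - hammingNorm u)) u

/-- A bit-level program for `P` processors with a common memory that runs for `T` time steps, with
input bits indexed by `ι` and output bits indexed by `κ`. In time step `t` each processor `q` reads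
two memory cells, `src₁ t q` and `src₂ t q`, applies one Boolean operation to the two bits, and
writes the resulting bit to the memory cell `(t, q)`. The cells `Sum.inl i` hold the input. With
`P = 1` this is a sequential (straight-line) program with running time `T`. -/
structure BitProgram (ι κ : Type) (P T : ℕ) where
  op : Fin T → Fin P → ZMod 2 → ZMod 2 → ZMod 2
  src₁ : Fin T → Fin P → ι ⊕ (Fin T × Fin P)
  src₂ : Fin T → Fin P → ι ⊕ (Fin T × Fin P)
  out : κ → ι ⊕ (Fin T × Fin P)

namespace BitProgram

variable {ι κ : Type} {P T : ℕ}

/-- The content of the memory after `t` time steps on input `x`. Unwritten cells contain `0`. -/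
def mem (A : BitProgram ι κ P T) (x : ι → ZMod 2) : ℕ → ι ⊕ (Fin T × Fin P) → ZMod 2
  | 0 => Sum.elim x (fun _ => 0)
  | t + 1 => Sum.elim x (fun c =>
      if c.1.val = t then
        A.op c.1 c.2 (A.mem x t (A.src₁ c.1 c.2)) (A.mem x t (A.src₂ c.1 c.2))
      else A.mem x t (Sum.inr c))

/-- The output of the program: the designated cells after all `T` time steps. -/
def eval (A : BitProgram ι κ P T) (x : ι → ZMod 2) : κ → ZMod 2 :=
  fun k => A.mem x T (A.out k)

end BitProgram

/-- A decoder for a CSS code that runs on `P` processors in `T` time steps. -/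
abbrev Decoder {N : ℕ} (Q : CSSCode N) (P T : ℕ) : Type :=
  BitProgram (Fin Q.rX ⊕ Fin Q.rZ) (Fin N ⊕ Fin N) P T

/-- The error correction capability of the decoders `D i` of the codes `Q i` of length `N i`:
every `Z`-error of weight at most `δ N / log N` is corrected and, if every qubit independently
suffers an `X`-error with probability `p < 1 / 4 ^ (c + 1)`, then, except with probability
`o(N ^ (-c))`, the `X`-error is corrected together with any such `Z`-error. -/
def CorrectsErrors (N : ℕ → ℕ) (Q : ∀ i, CSSCode (N i))
    (D : ∀ i, (Q i).Syndrome → (Fin (N i) ⊕ Fin (N i) → ZMod 2)) (δ : ℝ) : Prop :=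
  (∀ i, ∀ v : Bits (N i), (hammingNorm v : ℝ) ≤ δ * N i / Real.log (N i) →
    (Q i).Corrects (D i) 0 v) ∧
  (∀ c : ℝ, 0 < c → ∀ p : ℝ, 0 ≤ p → p < 1 / 4 ^ (c + 1) →
    Tendsto (fun i => (N i : ℝ) ^ c * bernoulliProb p {u : Bits (N i) |
        ∃ v : Bits (N i), (hammingNorm v : ℝ) ≤ δ * N i / Real.log (N i) ∧
          ¬ (Q i).Corrects (D i) u v})
      atTop (𝓝 0))

/-!
The code is the concatenation of a classical expander code with a repetition code of length
`Θ(log N)`. The repetition code alone protects against `X`-errors: a block is decoded wrongly only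
if more than half of its bits are flipped, which for a block of length `2 h + 1` has probability at
most `(4 p (1 - p)) ^ h`; this is a power of `N` small enough for a union bound over the blocks.
Majorities are computed in linear time by chains of full adders.

A `Z`-error acts on a block, up to stabilizers, only through its parity, so the outer code has to
correct the block parities. A random bipartite graph of bounded degree expands sets of up to a
linear number of variables, and each round of parallel bit flipping (Sipser–Spielman) halves the
weight of the remaining error. A round takes constant time with one processor per variable, and
logarithmically many rounds remove every error.
-/

theorem zmod_two_eq_one_of_ne_zero : ∀ {b : ZMod 2}, b ≠ 0 → b = 1 := by
  decide

namespace BitProgram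

variable {ι ι' κ κ' μ : Type} {P P' T T' T₁ T₂ : ℕ}

theorem mem_inl (A : BitProgram ι κ P T) (x : ι → ZMod 2) (t : ℕ) (i : ι) :
    A.mem x t (Sum.inl i) = x i := by
  cases t <;> rfl

theorem mem_succ_inr (A : BitProgram ι κ P T) (x : ι → ZMod 2) (t : ℕ) (c : Fin T × Fin P) :
    A.mem x (t + 1) (Sum.inr c) = if c.1.val = t then
        A.op c.1 c.2 (A.mem x t (A.src₁ c.1 c.2)) (A.mem x t (A.src₂ c.1 c.2))
      else A.mem x t (Sum.inr c) := rfl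

theorem mem_inr_eq_zero (A : BitProgram ι κ P T) (x : ι → ZMod 2) {t : ℕ} {c : Fin T × Fin P}
    (h : t ≤ c.1.val) : A.mem x t (Sum.inr c) = 0 := by
  induction t with
  | zero => rfl
  | succ t ih => rw [mem_succ_inr, if_neg (by omega), ih (by omega)]

theorem mem_inr_of_lt (A : BitProgram ι κ P T) (x : ι → ZMod 2) {t : ℕ} {c : Fin T × Fin P}
    (h : c.1.val < t) : A.mem x t (Sum.inr c) = A.mem x (c.1.val + 1) (Sum.inr c) := by
  induction t with
  | zero => omega
  | succ t ih =>
    rcases Nat.lt_succ_iff_lt_or_eq.1 h with h | h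
    · rw [mem_succ_inr, if_neg (by omega), ih h]
    · rw [h]

theorem mem_add (A : BitProgram ι κ P T) (x : ι → ZMod 2) (t : ℕ) (z : ι ⊕ (Fin T × Fin P)) :
    A.mem x (T + t) z = A.mem x T z := by
  rcases z with i | c
  · rw [mem_inl, mem_inl]
  · rw [mem_inr_of_lt _ _ (by omega), mem_inr_of_lt (t := T) _ _ (by omega)]

theorem mem_of_embedding (A : BitProgram ι κ P T) (B : BitProgram ι' κ' P' T')
    (x : ι → ZMod 2) (x' : ι' → ZMod 2) {t₀ : ℕ} {φ : ι → ι' ⊕ (Fin T' × Fin P')}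
    {e : Fin T × Fin P → Fin T' × Fin P'}
    (input : ∀ t i, B.mem x' (t₀ + t) (φ i) = x i)
    (time : ∀ c, (e c).1.val = t₀ + c.1.val)
    (op : ∀ c, B.op (e c).1 (e c).2 = A.op c.1 c.2)
    (src₁ : ∀ c, B.src₁ (e c).1 (e c).2 = Sum.elim φ (Sum.inr ∘ e) (A.src₁ c.1 c.2))
    (src₂ : ∀ c, B.src₂ (e c).1 (e c).2 = Sum.elim φ (Sum.inr ∘ e) (A.src₂ c.1 c.2))
    (t : ℕ) (z : ι ⊕ (Fin T × Fin P)) :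
    B.mem x' (t₀ + t) (Sum.elim φ (Sum.inr ∘ e) z) = A.mem x t z := by
  induction t generalizing z with
  | zero =>
    rcases z with i | c
    · exact input 0 i
    · exact mem_inr_eq_zero _ _ ((time c).symm ▸ Nat.le_add_right _ _)
  | succ t ih =>
    rcases z with i | c
    · rw [mem_inl]
      exact input (t + 1) i
    · have ih_cell : B.mem x' (t₀ + t) (Sum.inr (e c)) = A.mem x t (Sum.inr c) := ih (Sum.inr c)
      rw [Sum.elim_inr, Function.comp_apply, ← add_assoc, mem_succ_inr, mem_succ_inr, time, op,
        src₁, src₂, ih, ih, ih_cell]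
      simp only [Nat.add_left_cancel_iff]

/-- Sequential composition: `A` runs first and `B` runs on the output of `A`. -/
def comp (B : BitProgram κ μ P T₂) (A : BitProgram ι κ P T₁) : BitProgram ι μ P (T₁ + T₂) :=
  let fst : ι ⊕ (Fin T₁ × Fin P) → ι ⊕ (Fin (T₁ + T₂) × Fin P) :=
    Sum.elim Sum.inl (Sum.inr ∘ Prod.map (Fin.castAdd T₂) id)
  let snd : κ ⊕ (Fin T₂ × Fin P) → ι ⊕ (Fin (T₁ + T₂) × Fin P) :=
    Sum.elim (fst ∘ A.out) (Sum.inr ∘ Prod.map (Fin.natAdd T₁) id)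
  { op := Fin.addCases A.op B.op
    src₁ := Fin.addCases (fun t q => fst (A.src₁ t q)) (fun t q => snd (B.src₁ t q))
    src₂ := Fin.addCases (fun t q => fst (A.src₂ t q)) (fun t q => snd (B.src₂ t q))
    out := snd ∘ B.out }

theorem comp_eval (B : BitProgram κ μ P T₂) (A : BitProgram ι κ P T₁) (x : ι → ZMod 2) :
    (B.comp A).eval x = B.eval (A.eval x) := by
  have fst_mem (t : ℕ) (z) := mem_of_embedding A (B.comp A) x x (t₀ := 0) (φ := Sum.inl)
    (e := Prod.map (Fin.castAdd T₂) id) (fun _ _ => mem_inl _ _ _ _) (by simp)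
    (by simp [comp]) (by simp [comp]) (by simp [comp]) t z
  funext k
  refine mem_of_embedding B (B.comp A) (A.eval x) x (t₀ := T₁)
    (φ := Sum.elim Sum.inl (Sum.inr ∘ Prod.map (Fin.castAdd T₂) id) ∘ A.out)
    (e := Prod.map (Fin.natAdd T₁) id) (fun t k => ?_) (by simp)
    (by simp [comp]) (by simp [comp]) (by simp [comp]) T₂ (B.out k)
  rw [← zero_add (T₁ + t), Function.comp_apply, fst_mem, mem_add, eval]

/-- Parallel composition: each processor runs its own program. -/
def pi {κ : Fin P → Type} (A : ∀ q, BitProgram ι (κ q) 1 T) : BitProgram ι (Σ q, κ q) P T where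
  op t q := (A q).op t 0
  src₁ t q := Sum.elim Sum.inl (Sum.inr ∘ fun c => (c.1, q)) ((A q).src₁ t 0)
  src₂ t q := Sum.elim Sum.inl (Sum.inr ∘ fun c => (c.1, q)) ((A q).src₂ t 0)
  out k := Sum.elim Sum.inl (Sum.inr ∘ fun c => (c.1, k.1)) ((A k.1).out k.2)

theorem pi_eval {κ : Fin P → Type} (A : ∀ q, BitProgram ι (κ q) 1 T) (x : ι → ZMod 2)
    (k : Σ q, κ q) : (pi A).eval x k = (A k.1).eval x k.2 := by
  have processor (c : Fin T × Fin 1) : c.2 = 0 := Subsingleton.elim _ _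
  have h := mem_of_embedding (A k.1) (pi A) x x (t₀ := 0) (φ := Sum.inl)
    (e := fun c => (c.1, k.1)) (fun _ _ => mem_inl _ _ _ _) (by simp)
    (by simp [pi, processor]) (by simp [pi, processor]) (by simp [pi, processor]) T
    ((A k.1).out k.2)
  rwa [zero_add] at h

/-- The program `A` with its input added to its output. -/
def keep (A : BitProgram ι κ P T) : BitProgram ι (ι ⊕ κ) P T where
  op := A.op
  src₁ := A.src₁
  src₂ := A.src₂
  out := Sum.elim Sum.inl A.out

theorem keep_eval (A : BitProgram ι κ P T) (x : ι → ZMod 2) :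
    A.keep.eval x = Sum.elim x (A.eval x) := by
  have mem_keep (t : ℕ) (z) := mem_of_embedding A A.keep x x (t₀ := 0) (φ := Sum.inl) (e := id)
    (fun _ _ => mem_inl _ _ _ _) (by simp) (by simp [keep]) (by simp [keep]) (by simp [keep]) t z
  simp only [zero_add, Function.comp_id, Sum.elim_inl_inr, id_eq] at mem_keep
  funext k
  rcases k with i | k
  · exact mem_inl _ _ _ _
  · exact mem_keep T (A.out k)

/-- The memory cell that the sequential simulation of a parallel program reads in place of the cell
`z` when it simulates the step `c`. A cell not yet written at the start of the time step of `c`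
contains `0`; it is replaced by the cell of `c` itself, since in the simulation an earlier
processor may already have written it. -/
def seqCell (c : Fin T × Fin P) (z : ι ⊕ (Fin T × Fin P)) : ι ⊕ (Fin (T * P) × Fin 1) :=
  z.map id fun c' => (finProdFinEquiv (if c'.1 < c.1 then c' else c), 0)

/-- The simulation of a parallel program by a single processor. -/
def sequential (A : BitProgram ι κ P T) : BitProgram ι κ 1 (T * P) where
  op s _ := A.op (finProdFinEquiv.symm s).1 (finProdFinEquiv.symm s).2
  src₁ s _ := seqCell (finProdFinEquiv.symm s)
    (A.src₁ (finProdFinEquiv.symm s).1 (finProdFinEquiv.symm s).2)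
  src₂ s _ := seqCell (finProdFinEquiv.symm s)
    (A.src₂ (finProdFinEquiv.symm s).1 (finProdFinEquiv.symm s).2)
  out k := (A.out k).map id fun c => (finProdFinEquiv c, 0)

theorem finProdFinEquiv_lt {c c' : Fin T × Fin P} (h : c'.1 < c.1) :
    (finProdFinEquiv c').val < (finProdFinEquiv c).val := by
  have hP := c'.2.isLt
  have hT : P * (c'.1.val + 1) ≤ P * c.1.val := Nat.mul_le_mul_left P h
  rw [mul_add] at hT
  simp only [finProdFinEquiv_apply_val]
  omega

theorem sequential_mem (A : BitProgram ι κ P T) (x : ι → ZMod 2) (s : ℕ) (c : Fin T × Fin P) :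
    A.sequential.mem x s (Sum.inr (finProdFinEquiv c, 0)) =
      if (finProdFinEquiv c).val < s then A.mem x T (Sum.inr c) else 0 := by
  induction s generalizing c with
  | zero => rfl
  | succ s ih =>
    rw [mem_succ_inr]
    by_cases hc : (finProdFinEquiv c).val = s
    · have read (z : ι ⊕ (Fin T × Fin P)) :
          A.sequential.mem x s (seqCell c z) = A.mem x c.1.val z := by
        rcases z with i | c'
        · exact (mem_inl _ _ _ _).trans (mem_inl _ _ _ _).symm
        · refine (ih _).trans ?_
          by_cases h : c'.1 < c.1
          · rw [if_pos h, if_pos (hc ▸ finProdFinEquiv_lt h), mem_inr_of_lt _ _ c'.1.isLt,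
              ← mem_inr_of_lt _ _ h]
          · rw [if_neg h, if_neg hc.not_lt, mem_inr_eq_zero _ _ (not_lt.1 h)]
      rw [if_pos hc, if_pos (by omega), mem_inr_of_lt _ _ c.1.isLt, mem_succ_inr, if_pos rfl,
        ← read, ← read]
      simp only [sequential, Equiv.symm_apply_apply]
    · rw [if_neg hc, ih]
      simp only [Nat.lt_succ_iff_lt_or_eq, hc, or_false]

theorem sequential_eval (A : BitProgram ι κ P T) (x : ι → ZMod 2) :
    A.sequential.eval x = A.eval x := by
  funext k
  change A.sequential.mem x (T * P) (Sum.map id _ (A.out k)) = A.mem x T (A.out k)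
  rcases A.out k with i | c
  · exact (mem_inl _ _ _ _).trans (mem_inl _ _ _ _).symm
  · exact (sequential_mem A x _ c).trans (if_pos (Fin.isLt _))

end BitProgram

/-- The map `g` is computed by some program for `P` processors in `T` time steps. -/
def Computes {ι κ : Type} (P T : ℕ) (g : (ι → ZMod 2) → κ → ZMod 2) : Prop :=
  ∃ A : BitProgram ι κ P T, ∀ x, A.eval x = g x

namespace Computes

variable {ι κ μ : Type} {P T T₁ T₂ : ℕ}

theorem congr {g g' : (ι → ZMod 2) → κ → ZMod 2} (h : Computes P T g) (e : ∀ x k, g x k = g' x k) :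
    Computes P T g' := by
  have : g = g' := funext₂ e
  exact this ▸ h

theorem proj (P T : ℕ) (φ : κ → ι) : Computes P T (fun x k => x (φ k)) :=
  ⟨⟨fun _ _ _ _ => 0, fun t q => Sum.inr (t, q), fun t q => Sum.inr (t, q),
    fun k => Sum.inl (φ k)⟩, fun _ => funext fun _ => BitProgram.mem_inl _ _ _ _⟩

theorem comp {g : (ι → ZMod 2) → κ → ZMod 2} {h : (κ → ZMod 2) → μ → ZMod 2}
    (hh : Computes P T₂ h) (hg : Computes P T₁ g) : Computes P (T₁ + T₂) (fun x => h (g x)) := by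
  obtain ⟨A, hA⟩ := hg
  obtain ⟨B, hB⟩ := hh
  exact ⟨B.comp A, fun x => by rw [BitProgram.comp_eval, hA, hB]⟩

theorem mono {g : (ι → ZMod 2) → κ → ZMod 2} (hg : Computes P T₁ g) (h : T₁ ≤ T₂) :
    Computes P T₂ g := by
  obtain ⟨d, rfl⟩ := Nat.exists_eq_add_of_le h
  exact (proj P d id).comp hg

theorem postproj {g : (ι → ZMod 2) → κ → ZMod 2} (hg : Computes P T g) (φ : μ → κ) :
    Computes P T (fun x k => g x (φ k)) :=
  (proj P 0 φ).comp hg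

theorem preproj {g : (ι → ZMod 2) → κ → ZMod 2} (hg : Computes P T g) (φ : ι → μ) :
    Computes P T (fun x => g (fun i => x (φ i))) :=
  (hg.comp (proj P 0 φ)).mono (by omega)

theorem keep {g : (ι → ZMod 2) → κ → ZMod 2} (hg : Computes P T g) :
    Computes P T (fun x => Sum.elim x (g x)) := by
  obtain ⟨A, hA⟩ := hg
  exact ⟨A.keep, fun x => by rw [A.keep_eval, hA]⟩

theorem pair {g : (ι → ZMod 2) → κ → ZMod 2} {h : (ι → ZMod 2) → μ → ZMod 2}
    (hg : Computes P T₁ g) (hh : Computes P T₂ h) :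
    Computes P (T₁ + T₂) (fun x => Sum.elim (g x) (h x)) := by
  refine (((hh.preproj (Sum.inl : ι → ι ⊕ κ)).keep.comp hg.keep).postproj
    (Sum.elim (fun k => Sum.inl (Sum.inr k)) Sum.inr : κ ⊕ μ → (ι ⊕ κ) ⊕ μ)).congr ?_
  rintro x (k | k) <;> rfl

theorem sequential {g : (ι → ZMod 2) → κ → ZMod 2} (hg : Computes P T g) :
    Computes 1 (T * P) g := by
  obtain ⟨A, hA⟩ := hg
  exact ⟨A.sequential, fun x => by rw [BitProgram.sequential_eval, hA]⟩

theorem pi {κ : Fin P → Type} {g : ∀ q, (ι → ZMod 2) → κ q → ZMod 2}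
    (hg : ∀ q, Computes 1 T (g q)) : Computes P T (fun x (k : Σ q, κ q) => g k.1 x k.2) := by
  choose A hA using hg
  exact ⟨BitProgram.pi A, fun x => funext fun k => by rw [BitProgram.pi_eval, hA]⟩

theorem pi_unit {g : Fin P → (ι → ZMod 2) → ZMod 2}
    (hg : ∀ q, Computes 1 T (fun x (_ : Unit) => g q x)) :
    Computes P T (fun x q => g q x) :=
  (pi hg).postproj (fun q => ⟨q, ()⟩)

theorem gate [NeZero P] (op : ZMod 2 → ZMod 2 → ZMod 2) (a b : ι) :
    Computes P 1 (fun x (_ : Unit) => op (x a) (x b)) :=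
  ⟨⟨fun _ _ => op, fun _ _ => Sum.inl a, fun _ _ => Sum.inl b, fun _ => Sum.inr (0, 0)⟩,
    fun x => funext fun k => by simp [BitProgram.eval, BitProgram.mem]⟩

theorem const [NeZero P] (b : ZMod 2) : Computes P 1 (fun (_ : ι → ZMod 2) (_ : κ) => b) :=
  ⟨⟨fun _ _ _ _ => b, fun _ _ => Sum.inr (0, 0), fun _ _ => Sum.inr (0, 0),
    fun _ => Sum.inr (0, 0)⟩, fun x => funext fun k => by simp [BitProgram.eval, BitProgram.mem]⟩

theorem mux : Computes 1 3 (fun (x : Fin 3 → ZMod 2) (_ : Unit) =>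
    if x 0 = 0 then x 1 else x 2) := by
  have sum := (gate (P := 1) (· + ·) (1 : Fin 3) 2).keep
  have prod := (gate (P := 1) (· * ·) (Sum.inl 0 : Fin 3 ⊕ Unit) (Sum.inr ())).keep
  have result :=
    gate (P := 1) (· + ·) (Sum.inl (Sum.inl 1) : (Fin 3 ⊕ Unit) ⊕ Unit) (Sum.inr ())
  refine (result.comp (prod.comp sum)).congr fun x _ => ?_
  have mux_eq : ∀ a b c : ZMod 2, b + a * (b + c) = if a = 0 then b else c := by decide
  exact mux_eq _ _ _

theorem of_dependsOn (D : Finset ι) {F : (ι → ZMod 2) → ZMod 2}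
    (hF : DependsOn F (D : Set ι)) :
    Computes 1 (4 ^ (D.card + 1)) (fun x (_ : Unit) => F x) := by
  classical
  induction D using Finset.induction_on generalizing F with
  | empty => exact ((const (F 0)).congr fun x _ => hF (by simp)).mono (by simp)
  | insert a D ha ih =>
    have branch (b : ZMod 2) : Computes 1 (4 ^ (D.card + 1))
        (fun x (_ : Unit) => F (Function.update x a b)) := by
      refine ih fun x y h => hF fun i hi => ?_
      by_cases hia : i = a
      · rw [hia, Function.update_self, Function.update_self]
      · rw [Function.update_of_ne hia, Function.update_of_ne hia]
        exact h i (Finset.mem_of_mem_insert_of_ne hi hia)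
    have h := mux.comp (((proj 1 0 (fun _ : Unit => a)).pair ((branch 0).pair (branch 1))).postproj
      ![Sum.inl (), Sum.inr (Sum.inl ()), Sum.inr (Sum.inr ())])
    refine (h.congr (g' := fun x _ => F x) fun x _ => ?_).mono ?_
    · change (if x a = 0 then F (Function.update x a 0) else F (Function.update x a 1)) = F x
      split_ifs with hx
      · rw [← hx, Function.update_eq_self]
      · rw [← zmod_two_eq_one_of_ne_zero hx, Function.update_eq_self]
    · have : 4 ≤ 4 ^ (D.card + 1) := Nat.le_self_pow (by omega) 4
      rw [Finset.card_insert_of_notMem ha, pow_succ 4 (D.card + 1)]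
      omega

end Computes

theorem hammingNorm_eq_sum_val {ι : Type*} [Fintype ι] (x : ι → ZMod 2) :
    hammingNorm x = ∑ i, (x i).val := by
  have indicator_eq : ∀ b : ZMod 2, (if b ≠ 0 then 1 else 0) = b.val := by decide
  rw [hammingNorm, Finset.card_filter]
  exact Finset.sum_congr rfl fun i _ => indicator_eq _

/-- A full adder: the sum bit and the carry of three bits. -/
def fullAdder (x : Fin 3 → ZMod 2) : Fin 2 → ZMod 2 :=
  ![x 0 + x 1 + x 2, x 0 * x 1 + x 0 * x 2 + x 1 * x 2]

theorem fullAdder_val (x : Fin 3 → ZMod 2) :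
    2 * (fullAdder x 1).val + (fullAdder x 0).val = (x 0).val + (x 1).val + (x 2).val := by
  have adder : ∀ a b c : ZMod 2,
      2 * (a * b + a * c + b * c).val + (a + b + c).val = a.val + b.val + c.val := by decide
  exact adder _ _ _

theorem computes_fullAdder : Computes 1 512 fullAdder :=
  (Computes.pi_unit fun q => Computes.of_dependsOn (F := fun x => fullAdder x q) Finset.univ
    (by simpa only [Finset.coe_univ] using dependsOn_univ _)).sequential

/-- One pass of a chain of full adders over `2 * q + 1` bits: the last sum bit (at index `0`),
followed by the `q` carries. -/
def carrySave : ∀ q : ℕ, (Fin (2 * q + 1) → ZMod 2) → Fin (q + 1) → ZMod 2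
  | 0, x => x
  | q + 1, x =>
    let y := carrySave q (fun i => x i.succ.succ)
    let s := fullAdder ![y 0, x 0, x 1]
    Fin.cons (s 0) (Fin.cons (s 1) (Fin.tail y))

theorem sum_carrySave (q : ℕ) (x : Fin (2 * q + 1) → ZMod 2) :
    2 * ∑ i : Fin q, (carrySave q x i.succ).val + (carrySave q x 0).val = ∑ i, (x i).val := by
  induction q with
  | zero => simp [carrySave]
  | succ q ih =>
    let y := carrySave q fun i => x (Fin.succ (Fin.succ i))
    have hy : 2 * ∑ i : Fin q, (y i.succ).val + (y 0).val =
        ∑ i : Fin (2 * q + 1), (x i.succ.succ).val := ih _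
    have hs : 2 * (fullAdder ![y 0, x 0, x 1] 1).val + (fullAdder ![y 0, x 0, x 1] 0).val =
        (y 0).val + (x 0).val + (x 1).val := fullAdder_val _
    have hx : ∑ i, (x i).val = (x 0).val + ((x 1).val +
        ∑ i : Fin (2 * q + 1), (x i.succ.succ).val) :=
      (Fin.sum_univ_succ _).trans (congrArg _ (Fin.sum_univ_succ _))
    rw [Fin.sum_univ_succ, hx, ← hy]
    change 2 * ((fullAdder ![y 0, x 0, x 1] 1).val + ∑ i : Fin q, (y i.succ).val) +
      (fullAdder ![y 0, x 0, x 1] 0).val = _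
    omega

theorem computes_carrySave (q : ℕ) : Computes 1 (512 * q) (carrySave q) := by
  induction q with
  | zero => exact Computes.proj 1 0 id
  | succ q ih =>
    have tail : Computes 1 (512 * q) (fun (x : Fin (2 * q + 1 + 1 + 1) → ZMod 2) =>
        Sum.elim x (carrySave q fun i => x i.succ.succ)) :=
      (ih.preproj fun i : Fin (2 * q + 1) => i.succ.succ).keep
    have head := (computes_fullAdder.preproj
      (![Sum.inr 0, Sum.inl 0, Sum.inl 1] : Fin 3 → Fin (2 * q + 1 + 1 + 1) ⊕ Fin (q + 1))).keep
    refine (((head.comp tail).postproj (Fin.cons (Sum.inr 0) (Fin.cons (Sum.inr 1)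
      fun i : Fin q => Sum.inl (Sum.inr i.succ)) : Fin (q + 1 + 1) → _)).congr
      fun x k => ?_).mono (by omega)
    have inputs : (fun i => (Sum.elim x (carrySave q fun i => x i.succ.succ) :
          Fin (2 * q + 1 + 1 + 1) ⊕ Fin (q + 1) → ZMod 2)
        ((![Sum.inr 0, Sum.inl 0, Sum.inl 1] : Fin 3 → _) i)) =
        ![carrySave q (fun i => x i.succ.succ) 0, x 0, x 1] := by
      funext i
      fin_cases i <;> rfl
    rw [carrySave, inputs]
    refine Fin.cases rfl (fun k => ?_) k
    exact Fin.cases rfl (fun k => rfl) k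

/-- The majority bit of `n` bits; a tie counts as `0`. -/
def majority {n : ℕ} (x : Fin n → ZMod 2) : ZMod 2 :=
  if n < 2 * hammingNorm x then 1 else 0

theorem majority_carrySave {q : ℕ} (hq : Odd q) (x : Fin (2 * q + 1) → ZMod 2) :
    majority (fun i : Fin q => carrySave q x i.succ) = majority x := by
  have hsum := sum_carrySave q x
  have hbit := ZMod.val_lt (carrySave q x 0)
  obtain ⟨k, rfl⟩ := hq
  rw [majority, majority, hammingNorm_eq_sum_val, hammingNorm_eq_sum_val]
  exact if_congr (by omega) rfl rfl

theorem computes_majority_of_add_one_eq_two_pow {n r : ℕ} (hn : n + 1 = 2 ^ (r + 1)) :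
    Computes 1 (512 * n) (fun (x : Fin n → ZMod 2) (_ : Unit) => majority x) := by
  induction r generalizing n with
  | zero =>
    obtain rfl : n = 1 := by omega
    refine ((Computes.proj 1 0 fun _ => 0).congr fun x _ => ?_).mono (Nat.zero_le _)
    have majority_one : ∀ b : ZMod 2, b = if 1 < 2 * b.val then 1 else 0 := by decide
    rw [majority, hammingNorm_eq_sum_val, Fin.sum_univ_one]
    exact majority_one _
  | succ r ih =>
    obtain ⟨q, hq⟩ : ∃ q, q + 1 = 2 ^ (r + 1) :=
      ⟨2 ^ (r + 1) - 1, Nat.sub_add_cancel Nat.one_le_two_pow⟩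
    have hodd : Odd q := ⟨2 ^ r - 1, by have := Nat.one_le_two_pow (n := r); omega⟩
    obtain rfl : n = 2 * q + 1 := by omega
    exact ((((ih hq).preproj Fin.succ).comp (computes_carrySave q)).congr
      fun x _ => majority_carrySave hodd x).mono (by omega)

theorem majority_append {n k : ℕ} (hodd : Odd (n + k)) (x : Fin n → ZMod 2) :
    majority (Fin.append x (Fin.append (fun _ : Fin (k - k / 2) => 0) fun _ : Fin (k / 2) => 1)) =
      majority x := by
  rw [majority, majority, hammingNorm_eq_sum_val, hammingNorm_eq_sum_val]
  simp only [Fin.sum_univ_add, Fin.append_left, Fin.append_right, ZMod.val_zero,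
    Finset.sum_const_zero, zero_add, Finset.sum_const, Finset.card_fin, smul_eq_mul, ZMod.val_one,
    mul_one]
  obtain ⟨l, hl⟩ := hodd
  exact if_congr (by omega) rfl rfl

theorem computes_majority (n : ℕ) :
    Computes 1 (1024 * (n + 1)) (fun (x : Fin n → ZMod 2) (_ : Unit) => majority x) := by
  obtain ⟨k, r, hk, hle⟩ : ∃ k r, n + (k - k / 2 + k / 2) + 1 = 2 ^ (r + 1) ∧ k ≤ n + 1 := by
    have hlt := Nat.lt_pow_succ_log_self one_lt_two n
    have hle : 2 ^ Nat.log 2 n ≤ n + 1 := by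
      rcases Nat.eq_zero_or_pos n with rfl | hn
      · simp
      · exact (Nat.pow_log_le_self 2 hn.ne').trans n.le_succ
    refine ⟨2 ^ (Nat.log 2 n + 1) - (n + 1), Nat.log 2 n, ?_, ?_⟩ <;> grind
  have zeros : Computes 1 1 (fun (_ : Fin n → ZMod 2) (_ : Fin (k - k / 2)) => 0) :=
    Computes.const 0
  have ones : Computes 1 1 (fun (_ : Fin n → ZMod 2) (_ : Fin (k / 2)) => 1) := Computes.const 1
  have pad := (zeros.pair ones).keep.postproj
    (Fin.append Sum.inl (Sum.inr ∘ Fin.append Sum.inl Sum.inr))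
  refine (((computes_majority_of_add_one_eq_two_pow hk).comp pad).congr fun x _ => ?_).mono
    (by omega)
  rw [← majority_append (k := k) ⟨2 ^ r - 1, by grind⟩ x]
  congr 1
  funext i
  refine Fin.addCases (fun i => ?_) (fun i => ?_) i
  · simp only [Fin.append_left, Sum.elim_inl]
  · refine Fin.addCases (fun i => ?_) (fun i => ?_) i <;> simp [Fin.append_right]

/-- The decoder of the repetition code of length `q + 1` whose `q` parity checks compare the bit `0`
with every other bit. -/
def repetitionDecode {q : ℕ} (s : Fin q → ZMod 2) : Fin (q + 1) → ZMod 2 :=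
  Fin.cons (majority s) fun i => s i + majority s

theorem majority_add_eq {q : ℕ} {b : ZMod 2} {y : Fin q → ZMod 2}
    (h : 2 * (b.val + hammingNorm y) < q + 1) : majority (fun i => b + y i) = b := by
  rw [hammingNorm_eq_sum_val] at h
  rw [majority, hammingNorm_eq_sum_val]
  by_cases hb : b = 0
  · simp only [hb, zero_add, ZMod.val_zero] at h ⊢
    exact if_neg (by omega)
  · have flip_val : ∀ c : ZMod 2, (1 + c).val + c.val = 1 := by decide
    have hsum : ∑ i, ((1 + y i).val + (y i).val) = q := by simp [flip_val]
    rw [Finset.sum_add_distrib] at hsum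
    simp only [zmod_two_eq_one_of_ne_zero hb, ZMod.val_one] at h ⊢
    exact if_pos (by omega)

theorem repetitionDecode_eq {q : ℕ} {u : Fin (q + 1) → ZMod 2} (h : 2 * hammingNorm u < q + 1) :
    repetitionDecode (fun i => u 0 + u i.succ) = u := by
  have hmajority : majority (fun i : Fin q => u 0 + u i.succ) = u 0 :=
    majority_add_eq (by rwa [hammingNorm_eq_sum_val, ← Fin.sum_univ_succ (fun i => (u i).val),
      ← hammingNorm_eq_sum_val])
  funext j
  refine Fin.cases hmajority (fun i => ?_) j
  rw [repetitionDecode, hmajority, Fin.cons_succ, add_comm, CharTwo.add_cancel_left]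

theorem computes_repetitionDecode (q : ℕ) :
    Computes 1 (1025 * (q + 1)) (repetitionDecode (q := q)) := by
  have sums : Computes 1 (1 * q) (fun (z : Fin q ⊕ Unit → ZMod 2) (i : Fin q) =>
      z (Sum.inl i) + z (Sum.inr ())) :=
    (Computes.pi_unit fun i => Computes.gate (· + ·) (Sum.inl i : Fin q ⊕ Unit)
      (Sum.inr ())).sequential
  refine (((sums.keep.comp (computes_majority q).keep).postproj
    (Fin.cons (Sum.inl (Sum.inr ())) Sum.inr : Fin (q + 1) → _)).congr fun s k => ?_).mono
    (by omega)
  exact Fin.cases rfl (fun _ => rfl) k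

theorem pow_self_le_three_pow_mul_factorial (s : ℕ) : (s : ℝ) ^ s ≤ 3 ^ s * s.factorial := by
  have h := Real.pow_div_factorial_le_exp (s : ℝ) (by positivity) s
  rw [div_le_iff₀ (by positivity), ← mul_one (s : ℝ), Real.exp_nat_mul, mul_one] at h
  refine h.trans ?_
  gcongr
  exact Real.exp_one_lt_three.le

theorem choose_mul_div_pow_le (n s : ℕ) {m : ℝ} (hm : 0 ≤ m) :
    n.choose s * (s / m) ^ s ≤ (3 * (n / m)) ^ s := by
  calc n.choose s * (s / m : ℝ) ^ s
      ≤ n ^ s / s.factorial * (3 ^ s * s.factorial / m ^ s) := by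
        rw [div_pow]
        gcongr
        · exact Nat.choose_le_pow_div s n
        · exact pow_self_le_three_pow_mul_factorial s
    _ = (3 * (n / m)) ^ s := by
        rw [mul_pow, div_pow]
        field_simp

theorem choose_mul_choose_mul_pow_le {a l m s : ℕ} (hm : 0 < m)
    (h : 4 * 3 ^ (a + 1) * a ^ 2 * l * s ≤ m) :
    ((l * m).choose s * m.choose (a * s) * ((a * s : ℕ) / m : ℝ) ^ ((a + 2) * s) : ℝ) ≤
      (1 / 4) ^ s := by
  have hm' : (0 : ℝ) < m := by exact_mod_cast hm
  have h' : 4 * 3 ^ (a + 1) * a ^ 2 * l * s ≤ (m : ℝ) := by exact_mod_cast h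
  have left := choose_mul_div_pow_le (l * m) s hm'.le
  have right := choose_mul_div_pow_le m (a * s) hm'.le
  calc ((l * m).choose s * m.choose (a * s) * ((a * s : ℕ) / m : ℝ) ^ ((a + 2) * s) : ℝ)
      = (l * m).choose s * (s / m) ^ s * (m.choose (a * s) * ((a * s : ℕ) / m) ^ (a * s)) *
          (a ^ 2 * s / m) ^ s := by
        rw [add_mul, pow_add, mul_comm 2 s, pow_mul _ s 2, ← pow_mul, mul_comm s 2, pow_mul _ 2 s,
          show ((a * s : ℕ) / m : ℝ) ^ 2 = s / m * (a ^ 2 * s / m) by push_cast; ring, mul_pow]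
        ring
    _ ≤ (3 * ((l * m : ℕ) / m)) ^ s * (3 * (m / m)) ^ (a * s) * (a ^ 2 * s / m) ^ s := by gcongr
    _ = (3 ^ (a + 1) * a ^ 2 * l * s / m) ^ s := by
        rw [div_self hm'.ne', pow_mul _ a s, ← mul_pow, ← mul_pow]
        congr 1
        push_cast
        field_simp
        ring
    _ ≤ (1 / 4) ^ s := by
        refine pow_le_pow_left₀ (by positivity) ?_ s
        rw [div_le_iff₀ hm']
        linarith

section Expander

open Finset

variable {E V I C : Type*} [Fintype I] [DecidableEq C]

/-- The neighbours of a set `S` of left vertices in a bipartite multigraph with left vertices `V`,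
right vertices `C` and, for every `v : V`, edges `(v, i)` with `i : I` from `v` to `f (v, i)`. -/
def neighbors (f : V × I → C) (S : Finset V) : Finset C :=
  (S ×ˢ univ).image f

/-- Sets of at most `K` left vertices expand by a factor of at least `a`. -/
def IsExpander (f : V × I → C) (a K : ℕ) : Prop :=
  ∀ S : Finset V, #S ≤ K → a * #S ≤ #(neighbors f S)

theorem card_filter_mapsTo [Fintype E] [DecidableEq E] [Fintype C] [Nonempty C] (S : Finset E)
    (T : Finset C) : (#{f : E → C | ∀ e ∈ S, f e ∈ T} : ℝ) =
      (Fintype.card C : ℝ) ^ Fintype.card E * (#T / Fintype.card C : ℝ) ^ #S := by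
  have hpi : ({f : E → C | ∀ e ∈ S, f e ∈ T} : Finset (E → C)) =
      Fintype.piFinset fun e => if e ∈ S then T else univ := by
    ext f
    simp only [mem_filter, mem_univ, true_and, Fintype.mem_piFinset]
    exact forall_congr' fun e => by split_ifs with h <;> simp [h]
  have hfactor (e : E) : (#(if e ∈ S then T else univ) : ℝ) =
      Fintype.card C * if e ∈ S then (#T / Fintype.card C : ℝ) else 1 := by
    split_ifs
    · rw [mul_div_cancel₀ _ (by simp)]
    · rw [mul_one, card_univ]
  rw [hpi, Fintype.card_piFinset, Nat.cast_prod, prod_congr rfl fun e _ => hfactor e,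
    prod_mul_distrib, prod_const, card_univ, prod_ite_mem, univ_inter, prod_const]

theorem exists_mapsTo_of_not_isExpander [Fintype V] [Fintype C] {f : V × I → C} {a K : ℕ}
    (hK : a * K ≤ Fintype.card C) (hf : ¬ IsExpander f a K) :
    ∃ s ∈ Icc 1 K, ∃ S ∈ powersetCard s (univ : Finset V),
      ∃ T ∈ powersetCard (a * s) (univ : Finset C), ∀ e ∈ S ×ˢ univ, f e ∈ T := by
  unfold IsExpander at hf
  push Not at hf
  obtain ⟨S, hS, hlt⟩ := hf
  have hpos : 0 < #S := Nat.pos_of_ne_zero fun h => by simp [h] at hlt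
  obtain ⟨T, hT, -, hcard⟩ := exists_subsuperset_card_eq (subset_univ (neighbors f S)) hlt.le
    ((Nat.mul_le_mul_left a hS).trans hK)
  exact ⟨#S, mem_Icc.2 ⟨hpos, hS⟩, S, mem_powersetCard_univ.2 rfl, T, mem_powersetCard_univ.2 hcard,
    fun e he => hT (mem_image_of_mem f he)⟩

theorem exists_isExpander [Fintype V] [Fintype C] [Nonempty C] {a K : ℕ}
    (hK : a * K ≤ Fintype.card C)
    (h : ∑ s ∈ Icc 1 K, ((Fintype.card V).choose s * (Fintype.card C).choose (a * s) *
      ((a * s : ℕ) / Fintype.card C : ℝ) ^ (Fintype.card I * s) : ℝ) < 1) :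
    ∃ f : V × I → C, IsExpander f a K := by
  classical
  by_contra! hbad
  set M : ℝ := (Fintype.card C : ℝ) ^ Fintype.card (V × I)
  let B (S : Finset V) (T : Finset C) : Finset (V × I → C) := {f | ∀ e ∈ S ×ˢ univ, f e ∈ T}
  have hcover : (univ : Finset (V × I → C)) ⊆
      (Icc 1 K).biUnion fun s => (powersetCard s univ).biUnion fun S =>
        (powersetCard (a * s) univ).biUnion fun T => B S T := fun f _ => by
    simpa only [mem_biUnion, B, mem_filter, mem_univ, true_and, exists_prop] using
      exists_mapsTo_of_not_isExpander hK (hbad f)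
  have hB (s : ℕ) : ∀ S ∈ powersetCard s (univ : Finset V),
      ∀ T ∈ powersetCard (a * s) (univ : Finset C),
      (#(B S T) : ℝ) = M * ((a * s : ℕ) / Fintype.card C : ℝ) ^ (Fintype.card I * s) := by
    intro S hS T hT
    rw [card_filter_mapsTo, card_product, card_univ, (mem_powersetCard.1 hS).2,
      (mem_powersetCard.1 hT).2, mul_comm s]
  have hle : M ≤ M * ∑ s ∈ Icc 1 K, ((Fintype.card V).choose s * (Fintype.card C).choose (a * s) *
      ((a * s : ℕ) / Fintype.card C : ℝ) ^ (Fintype.card I * s) : ℝ) := by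
    calc M = #(univ : Finset (V × I → C)) := by
          rw [card_univ, Fintype.card_fun, Nat.cast_pow]
      _ ≤ ∑ s ∈ Icc 1 K, ∑ S ∈ powersetCard s univ, ∑ T ∈ powersetCard (a * s) univ,
            (#(B S T) : ℝ) := by
          exact_mod_cast (card_le_card hcover).trans (card_biUnion_le.trans
            (sum_le_sum fun _ _ => card_biUnion_le.trans (sum_le_sum fun _ _ => card_biUnion_le)))
      _ = _ := by
          rw [mul_sum]
          refine sum_congr rfl fun s _ => ?_
          rw [sum_congr rfl fun S hS => sum_congr rfl (hB s S hS), sum_const, sum_const,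
            card_powersetCard, card_powersetCard, card_univ, card_univ, nsmul_eq_mul, nsmul_eq_mul]
          ring
  have hM : 0 < M := by positivity
  nlinarith

theorem sum_Icc_one_fourth_pow (K : ℕ) :
    ∑ s ∈ Icc 1 K, (1 / 4 : ℝ) ^ s = (1 - (1 / 4) ^ K) / 3 := by
  induction K with
  | zero => simp
  | succ K ih =>
    rw [sum_Icc_succ_top (by omega), ih]
    ring

theorem exists_isExpander_of_mul_le [Fintype V] [Fintype C] {a l K : ℕ} (hl : 0 < l)
    (hC : 0 < Fintype.card C) (hV : Fintype.card V = l * Fintype.card C)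
    (hI : Fintype.card I = a + 2) (hK : 4 * 3 ^ (a + 1) * a ^ 2 * l * K ≤ Fintype.card C) :
    ∃ f : V × I → C, IsExpander f a K := by
  have : Nonempty C := Fintype.card_pos_iff.1 hC
  have haK : a * K ≤ 4 * 3 ^ (a + 1) * a ^ 2 * l * K := by
    refine Nat.mul_le_mul_right K ((Nat.le_self_pow two_ne_zero a).trans ?_)
    calc a ^ 2 = 1 * a ^ 2 * 1 := by ring
      _ ≤ 4 * 3 ^ (a + 1) * a ^ 2 * l := by gcongr <;> first | exact hl | exact Nat.pos_of_neZero _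
  refine exists_isExpander (haK.trans hK) (lt_of_le_of_lt (sum_le_sum fun s hs => ?_)
    (?_ : ∑ s ∈ Icc 1 K, (1 / 4 : ℝ) ^ s < 1))
  · rw [hV, hI]
    exact choose_mul_choose_mul_pow_le hC
      ((Nat.mul_le_mul_left _ (mem_Icc.1 hs).2).trans hK)
  · have : (0 : ℝ) < (1 / 4) ^ K := by positivity
    rw [sum_Icc_one_fourth_pow]
    linarith

theorem exists_rank_in_fiber [Fintype E] (f : E → C) :
    ∃ r : E → ℕ, (∀ e, r e < #{e' | f e' = f e}) ∧ ∀ e e', f e = f e' → r e = r e' → e = e' := by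
  classical
  refine ⟨fun e => ({e' | f e' = f e} : Finset E).toList.idxOf e, fun e => ?_, fun e e' h hr => ?_⟩
  · rw [← length_toList]
    exact List.idxOf_lt_length_iff.2 (by simp)
  · simp only [h] at hr
    exact (List.idxOf_inj (by simp [h])).1 hr

/-- Each fibre of `f` is cut into chunks of `D` consecutive elements. -/
theorem exists_factorsThrough_card_fiber_le {α β : Type*} [Fintype α] [Fintype β] {D R : ℕ}
    (hD : 0 < D) (hR : Fintype.card α + Fintype.card β * D ≤ R * D) (f : α → β) :
    ∃ f' : α → Fin R, f.FactorsThrough f' ∧ ∀ c, #{e | f' e = c} ≤ D := by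
  classical
  obtain ⟨r, hlt, hinj⟩ := exists_rank_in_fiber f
  let chunk (e : α) : Σ _ : β, ℕ := ⟨f e, r e / D⟩
  have hchunks : #(univ.image chunk) ≤ R := by
    refine Nat.le_of_mul_le_mul_right (le_trans ?_ hR) hD
    calc #(univ.image chunk) * D
        ≤ #(univ.sigma fun c => range (#{e | f e = c} / D + 1)) * D := by
          refine Nat.mul_le_mul_right D (card_le_card (image_subset_iff.2 fun e _ => ?_))
          exact mem_sigma.2 ⟨mem_univ _,
            mem_range.2 (Nat.lt_succ_of_le (Nat.div_le_div_right (hlt e).le))⟩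
      _ ≤ ∑ c, (#{e | f e = c} + D) := by
          simp only [card_sigma, card_range, sum_mul, add_mul, one_mul]
          gcongr
          exact Nat.div_mul_le_self _ _
      _ = Fintype.card α + Fintype.card β * D := by
          rw [sum_add_distrib, sum_const, smul_eq_mul, card_univ,
            ← card_eq_sum_card_fiberwise fun e _ => mem_coe.2 (mem_univ (f e)), card_univ]
  let label (e : α) : Fin R :=
    Fin.castLE hchunks ((univ.image chunk).equivFin ⟨chunk e, mem_image_of_mem _ (mem_univ e)⟩)
  have hlabel {e e' : α} (h : label e = label e') : chunk e = chunk e' :=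
    congrArg Subtype.val ((Equiv.injective _) (Fin.castLE_injective hchunks h))
  refine ⟨label, fun e e' h => congrArg Sigma.fst (hlabel h), fun c => ?_⟩
  rcases (univ.filter fun e => label e = c).eq_empty_or_nonempty with hc | ⟨e₀, he₀⟩
  · simp [hc]
  have hsame {e : α} (he : e ∈ univ.filter fun e => label e = c) : chunk e = chunk e₀ :=
    hlabel ((mem_filter.1 he).2.trans (mem_filter.1 he₀).2.symm)
  refine (card_le_card_of_injOn r (t := Ico (r e₀ / D * D) (r e₀ / D * D + D))
    (fun e he => ?_) fun e he e' he' => ?_).trans (by simp)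
  · have hdiv : r e / D = r e₀ / D := congrArg Sigma.snd (hsame he)
    rw [← hdiv]
    exact mem_coe.2 (mem_Ico.2 ⟨Nat.div_mul_le_self _ _, Nat.lt_div_mul_add hD⟩)
  · exact hinj e e' (congrArg Sigma.fst ((hsame he).trans (hsame he').symm))

theorem IsExpander.of_factorsThrough {C' : Type*} [DecidableEq C'] {f : V × I → C} {f' : V × I → C'}
    {a K : ℕ} (hf : IsExpander f a K) (h : f.FactorsThrough f') : IsExpander f' a K := by
  intro S hS
  rcases isEmpty_or_nonempty (V × I) with hE | hE
  · have hempty (S : Finset (V × I)) : S = ∅ := eq_empty_of_isEmpty S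
    have := hf S hS
    rw [neighbors, hempty (S ×ˢ univ), image_empty, card_empty] at this ⊢
    exact this
  · have hfactor (e : V × I) : f (Function.invFun f' (f' e)) = f e :=
      h (Function.invFun_eq ⟨e, rfl⟩)
    have himage : neighbors f S = (neighbors f' S).image fun c => f (Function.invFun f' c) := by
      rw [neighbors, neighbors, image_image]
      exact image_congr fun e _ => (hfactor e).symm
    exact (hf S hS).trans (himage ▸ card_image_le)

theorem exists_isExpander_card_fiber_le {a l m K : ℕ} (hl : 0 < l) (hm : 0 < m)
    (hK : 4 * 3 ^ (a + 1) * a ^ 2 * l * K ≤ m) :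
    ∃ f : Fin (l * m) × Fin (a + 2) → Fin (2 * m), IsExpander f a K ∧
      ∀ c, #{e | f e = c} ≤ l * (a + 2) := by
  obtain ⟨f, hf⟩ := exists_isExpander_of_mul_le (a := a) (V := Fin (l * m)) (I := Fin (a + 2))
    (C := Fin m) hl (by simpa using hm) (by simp) (by simp) (by simpa using hK)
  obtain ⟨f', hfactor, hcard⟩ := exists_factorsThrough_card_fiber_le (D := l * (a + 2)) (R := 2 * m)
    (by positivity) (le_of_eq (by simp only [Fintype.card_prod, Fintype.card_fin]; ring)) f
  exact ⟨f', hf.of_factorsThrough hfactor, hcard⟩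

end Expander

section BitFlipping

open Finset

variable {V I C : Type*} [Fintype I]

/-- The edges at the variable `v` whose checks are unsatisfied according to the syndrome `s`. -/
def unsatisfied (f : V × I → C) (s : C → ZMod 2) (v : V) : Finset I :=
  {i | s (f (v, i)) ≠ 0}

theorem card_satisfied_edges (f : V × I → C) (s : C → ZMod 2) (A : Finset V) :
    #{e ∈ A ×ˢ univ | s (f e) = 0} + ∑ v ∈ A, #(unsatisfied f s v) = Fintype.card I * #A := by
  simp only [unsatisfied, card_filter, sum_product, ← sum_add_distrib]
  have hedge (v i) :
      ((if s (f (v, i)) = 0 then 1 else 0) + if s (f (v, i)) ≠ 0 then 1 else 0) = 1 := by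
    split_ifs <;> simp_all
  simp only [hedge, sum_const, smul_eq_mul, mul_one, card_univ, mul_comm]

/-- The variables for which a majority of the checks is unsatisfied. -/
def flips (f : V × I → C) (s : C → ZMod 2) (v : V) : ZMod 2 :=
  if Fintype.card I < 2 * #(unsatisfied f s v) then 1 else 0

variable [DecidableEq C]

/-- The checks that are joined to the set `S` of variables by exactly one edge. -/
def uniqueNeighbors (f : V × I → C) (S : Finset V) : Finset C :=
  {c ∈ neighbors f S | #{e ∈ S ×ˢ univ | f e = c} = 1}

theorem two_mul_card_neighbors_le (f : V × I → C) (S : Finset V) :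
    2 * #(neighbors f S) ≤ Fintype.card I * #S + #(uniqueNeighbors f S) := by
  have hedges : ∑ c ∈ neighbors f S, #{e ∈ S ×ˢ univ | f e = c} = Fintype.card I * #S := by
    rw [neighbors, ← card_eq_sum_card_image, card_product, card_univ, mul_comm]
  rw [← hedges, uniqueNeighbors, card_filter, ← sum_add_distrib, mul_comm, ← smul_eq_mul]
  refine card_nsmul_le_sum _ _ _ fun c hc => ?_
  obtain ⟨e, he, hec⟩ := mem_image.1 hc
  have hpos : 0 < #{e ∈ S ×ˢ univ | f e = c} := card_pos.2 ⟨e, mem_filter.2 ⟨he, hec⟩⟩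
  split_ifs <;> omega

theorem card_edges_notMem_uniqueNeighbors_le (f : V × I → C) (S : Finset V) :
    #{e ∈ S ×ˢ univ | f e ∉ uniqueNeighbors f S} + #(uniqueNeighbors f S) ≤
      Fintype.card I * #S := by
  have hsubset :
      uniqueNeighbors f S ⊆
        ({e ∈ S ×ˢ univ | f e ∈ uniqueNeighbors f S} : Finset (V × I)).image f := by
    intro c hc
    obtain ⟨e, he, rfl⟩ := mem_image.1 (mem_filter.1 hc).1
    exact mem_image_of_mem f (mem_filter.2 ⟨he, hc⟩)
  have hcard := card_filter_add_card_filter_not (s := S ×ˢ (univ : Finset I))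
    (fun e => f e ∈ uniqueNeighbors f S)
  rw [card_product, card_univ, mul_comm] at hcard
  have := (card_le_card hsubset).trans card_image_le
  omega

theorem IsExpander.card_edges_notMem_uniqueNeighbors_le {f : V × I → C} {a K : ℕ}
    (hf : IsExpander f a K) (ha : 15 * Fintype.card I ≤ 16 * a) {S : Finset V} (hS : #S ≤ K) :
    8 * #{e ∈ S ×ˢ univ | f e ∉ uniqueNeighbors f S} ≤ Fintype.card I * #S := by
  have hexpand := hf S hS
  have hneighbors := two_mul_card_neighbors_le f S
  have hedges := _root_.card_edges_notMem_uniqueNeighbors_le f S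
  have hratio := Nat.mul_le_mul_right #S ha
  rw [mul_assoc, mul_assoc] at hratio
  omega

variable [Fintype V]

/-- The parity-check matrix of the bipartite multigraph with edges from `v` to `f (v, i)`: the bits
of a word sit on `V`, its parity checks on `C`. -/
def tannerMatrix (f : V × I → C) : Matrix C V (ZMod 2) :=
  Matrix.of fun c v => ∑ i, if f (v, i) = c then 1 else 0

theorem tannerMatrix_mulVec (f : V × I → C) (x : V → ZMod 2) (c : C) :
    (tannerMatrix f *ᵥ x) c = ∑ e with f e = c, x e.1 := by
  simp only [Matrix.mulVec, dotProduct, tannerMatrix, Matrix.of_apply, sum_mul, sum_filter,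
    Fintype.sum_prod_type, ite_mul, one_mul, zero_mul]

theorem tannerMatrix_mulVec_eq_card (f : V × I → C) (x : V → ZMod 2) (c : C) :
    (tannerMatrix f *ᵥ x) c = #{e ∈ ({v | x v ≠ 0} : Finset V) ×ˢ univ | f e = c} := by
  rw [tannerMatrix_mulVec, card_filter, sum_product, sum_filter, Fintype.sum_prod_type, sum_filter]
  push_cast
  refine sum_congr rfl fun v _ => ?_
  split_ifs with h
  · rw [zmod_two_eq_one_of_ne_zero h]
  · simp [not_not.1 h]

theorem tannerMatrix_mulVec_ne_zero_of_mem_uniqueNeighbors {f : V × I → C} {r : V → ZMod 2} {c : C}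
    (hc : c ∈ uniqueNeighbors f {v | r v ≠ 0}) : (tannerMatrix f *ᵥ r) c ≠ 0 := by
  rw [tannerMatrix_mulVec_eq_card, (mem_filter.1 hc).2, Nat.cast_one]
  exact one_ne_zero

theorem mem_neighbors_of_tannerMatrix_mulVec_ne_zero {f : V × I → C} {r : V → ZMod 2} {c : C}
    (hc : (tannerMatrix f *ᵥ r) c ≠ 0) : c ∈ neighbors f {v | r v ≠ 0} := by
  rw [tannerMatrix_mulVec] at hc
  obtain ⟨e, he, hre⟩ := exists_ne_zero_of_sum_ne_zero hc
  obtain rfl := (mem_filter.1 he).2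
  exact mem_image_of_mem f (by simpa using hre)

/-- One round of parallel bit flipping: `x` is the current guess of the error with syndrome `s`. -/
def flipRound (f : V × I → C) (s : C → ZMod 2) (x : V → ZMod 2) : V → ZMod 2 :=
  x + flips f (s + tannerMatrix f *ᵥ x)

/-- The parallel bit-flipping algorithm of Sipser and Spielman with `k` rounds. -/
def flipDecode (f : V × I → C) (k : ℕ) (s : C → ZMod 2) : V → ZMod 2 :=
  (flipRound f s)^[k] 0

theorem IsExpander.card_filter_not_flipped_le [Nonempty I] {f : V × I → C} {a K : ℕ}
    (hf : IsExpander f a K) (ha : 15 * Fintype.card I ≤ 16 * a) {r : V → ZMod 2}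
    (hr : hammingNorm r ≤ K) :
    4 * #{v | r v ≠ 0 ∧ flips f (tannerMatrix f *ᵥ r) v = 0} ≤ hammingNorm r := by
  set y := tannerMatrix f *ᵥ r
  set F : Finset V := {v | r v ≠ 0 ∧ flips f y v = 0}
  have hsatisfied : 8 * #{e ∈ F ×ˢ univ | y (f e) = 0} ≤ Fintype.card I * hammingNorm r := by
    refine (Nat.mul_le_mul_left 8 (card_le_card fun e he => ?_)).trans
      (hf.card_edges_notMem_uniqueNeighbors_le ha hr)
    simp only [F, mem_filter, mem_product, mem_univ, and_true, true_and] at he ⊢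
    exact ⟨he.1.1, fun h => tannerMatrix_mulVec_ne_zero_of_mem_uniqueNeighbors h he.2⟩
  have hmajority : ∑ v ∈ F, 2 * #(unsatisfied f y v) ≤ #F * Fintype.card I := by
    refine sum_le_card_nsmul _ _ _ fun v hv => not_lt.1 fun h => ?_
    have hflip := (mem_filter.1 hv).2.2
    rw [flips, if_pos h] at hflip
    exact one_ne_zero hflip
  have hcount := card_satisfied_edges f y F
  rw [← mul_sum, mul_comm #F] at hmajority
  refine Nat.le_of_mul_le_mul_left (c := Fintype.card I) ?_ Fintype.card_pos
  rw [mul_left_comm]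
  omega

theorem IsExpander.card_flipped_subset_le [Nonempty I] {f : V × I → C} {a K : ℕ}
    (hf : IsExpander f a K) (ha : 15 * Fintype.card I ≤ 16 * a) {r : V → ZMod 2}
    (hr : 2 * hammingNorm r ≤ K) {G : Finset V}
    (hG : ∀ v ∈ G, r v = 0 ∧ flips f (tannerMatrix f *ᵥ r) v ≠ 0) (hle : #G ≤ hammingNorm r) :
    7 * #G ≤ hammingNorm r := by
  classical
  set y := tannerMatrix f *ᵥ r
  set S : Finset V := {v | r v ≠ 0}
  have hS : hammingNorm r = #S := rfl
  have hdisjoint : Disjoint S G :=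
    disjoint_left.2 fun v hv hv' => (mem_filter.1 hv).2 (hG v hv').1
  have hexpand := hf (S ∪ G) (by rw [card_union_of_disjoint hdisjoint]; omega)
  have hcover : neighbors f (S ∪ G) ⊆
      neighbors f S ∪ ({e ∈ G ×ˢ univ | y (f e) = 0} : Finset (V × I)).image f := by
    intro c hc
    obtain ⟨e, he, rfl⟩ := mem_image.1 hc
    by_cases hN : f e ∈ neighbors f S
    · exact mem_union_left _ hN
    · refine mem_union_right _ (mem_image_of_mem f (mem_filter.2 ⟨?_, ?_⟩))
      · refine mem_product.2 ⟨(mem_union.1 (mem_product.1 he).1).resolve_left fun h => hN ?_,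
          mem_univ _⟩
        exact mem_image_of_mem f (mem_product.2 ⟨h, mem_univ _⟩)
      · exact not_not.1 fun h => hN (mem_neighbors_of_tannerMatrix_mulVec_ne_zero h)
  have hneighbors : #(neighbors f S) ≤ Fintype.card I * #S :=
    card_image_le.trans (by rw [card_product, card_univ, mul_comm])
  have hmajority : #G * Fintype.card I ≤ ∑ v ∈ G, 2 * #(unsatisfied f y v) := by
    refine card_nsmul_le_sum _ _ _ fun v hv => ?_
    by_contra h
    exact (hG v hv).2 (if_neg fun h' => h h'.le)
  have hcount := card_satisfied_edges f y G
  have hunion := (hexpand.trans (card_le_card hcover)).trans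
    ((card_union_le _ _).trans (Nat.add_le_add hneighbors card_image_le))
  rw [card_union_of_disjoint hdisjoint] at hunion
  rw [← mul_sum, mul_comm #G] at hmajority
  have hratio := Nat.mul_le_mul_right (#S + #G) ha
  refine Nat.le_of_mul_le_mul_left (c := Fintype.card I) ?_ Fintype.card_pos
  rw [mul_assoc, mul_assoc, mul_add] at hratio
  rw [hS, mul_left_comm]
  omega

theorem IsExpander.card_filter_flipped_le [Nonempty I] {f : V × I → C} {a K : ℕ}
    (hf : IsExpander f a K) (ha : 15 * Fintype.card I ≤ 16 * a) {r : V → ZMod 2}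
    (hr : 2 * hammingNorm r ≤ K) :
    7 * #{v | r v = 0 ∧ flips f (tannerMatrix f *ᵥ r) v ≠ 0} ≤ hammingNorm r := by
  classical
  set G : Finset V := {v | r v = 0 ∧ flips f (tannerMatrix f *ᵥ r) v ≠ 0}
  have hG : ∀ v ∈ G, r v = 0 ∧ flips f (tannerMatrix f *ᵥ r) v ≠ 0 := fun v hv =>
    (mem_filter.1 hv).2
  rcases le_total #G (hammingNorm r) with h | h
  · exact hf.card_flipped_subset_le ha hr hG h
  · obtain ⟨G', hG', hcard⟩ := exists_subset_card_eq h
    have hle := hf.card_flipped_subset_le ha hr (fun v hv => hG v (hG' hv)) hcard.le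
    have hr0 : r = 0 := hammingNorm_eq_zero.1 (by omega)
    have hempty : G = ∅ := filter_false_of_mem fun v _ hv => hv.2 (by
      simp [hr0, flips, unsatisfied])
    simp [hempty]

theorem IsExpander.two_mul_hammingNorm_add_flips_le [Nonempty I] {f : V × I → C} {a K : ℕ}
    (hf : IsExpander f a K) (ha : 15 * Fintype.card I ≤ 16 * a) {r : V → ZMod 2}
    (hr : 2 * hammingNorm r ≤ K) :
    2 * hammingNorm (r + flips f (tannerMatrix f *ᵥ r)) ≤ hammingNorm r := by
  classical
  set y := tannerMatrix f *ᵥ r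
  have hwrong : hammingNorm (r + flips f y) ≤
      #(({v | r v ≠ 0 ∧ flips f y v = 0} : Finset V) ∪
        ({v | r v = 0 ∧ flips f y v ≠ 0} : Finset V)) := by
    refine card_le_card fun v hv => ?_
    have hsum : ∀ a b : ZMod 2, a + b ≠ 0 → a ≠ 0 ∧ b = 0 ∨ a = 0 ∧ b ≠ 0 := by decide
    simpa using hsum _ _ (mem_filter.1 hv).2
  have hnot_flipped : 4 * #{v | r v ≠ 0 ∧ flips f y v = 0} ≤ hammingNorm r :=
    hf.card_filter_not_flipped_le ha (by omega)
  have hflipped : 7 * #{v | r v = 0 ∧ flips f y v ≠ 0} ≤ hammingNorm r :=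
    hf.card_filter_flipped_le ha hr
  have := hwrong.trans (card_union_le _ _)
  omega

theorem IsExpander.two_pow_mul_hammingNorm_add_flipDecode_le [Nonempty I] {f : V × I → C}
    {a K : ℕ} (hf : IsExpander f a K) (ha : 15 * Fintype.card I ≤ 16 * a) {e : V → ZMod 2}
    (he : 2 * hammingNorm e ≤ K) (k : ℕ) :
    2 ^ k * hammingNorm (e + flipDecode f k (tannerMatrix f *ᵥ e)) ≤ hammingNorm e := by
  induction k with
  | zero => simp [flipDecode]
  | succ k ih =>
    set x := flipDecode f k (tannerMatrix f *ᵥ e)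
    have hround : e + flipDecode f (k + 1) (tannerMatrix f *ᵥ e) =
        e + x + flips f (tannerMatrix f *ᵥ (e + x)) := by
      rw [flipDecode, Function.iterate_succ_apply', Matrix.mulVec_add, add_assoc]
      rfl
    have hle : hammingNorm (e + x) ≤ hammingNorm e :=
      le_trans (Nat.le_mul_of_pos_left _ (by positivity)) ih
    rw [hround, pow_succ, mul_assoc]
    exact (Nat.mul_le_mul_left _ (hf.two_mul_hammingNorm_add_flips_le ha (by omega))).trans ih

theorem IsExpander.flipDecode_mulVec [Nonempty I] {f : V × I → C} {a K : ℕ}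
    (hf : IsExpander f a K) (ha : 15 * Fintype.card I ≤ 16 * a) {k : ℕ}
    (hk : Fintype.card V < 2 ^ k) {e : V → ZMod 2} (he : 2 * hammingNorm e ≤ K) :
    flipDecode f k (tannerMatrix f *ᵥ e) = e := by
  have hhalved := hf.two_pow_mul_hammingNorm_add_flipDecode_le ha he k
  have hcard : hammingNorm e ≤ Fintype.card V := hammingNorm_le_card_fintype
  have hzero : hammingNorm (e + flipDecode f k (tannerMatrix f *ᵥ e)) = 0 := by
    by_contra h
    have := Nat.le_mul_of_pos_right (2 ^ k) (Nat.pos_of_ne_zero h)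
    omega
  exact funext fun v => (CharTwo.add_eq_zero.1 (congrFun (hammingNorm_eq_zero.1 hzero) v)).symm

/-- The memory that the update of the variable `v` in a round of bit flipping depends on: the bits
`Sum.inl c` of the syndrome and the bits `Sum.inr w` of the current guess. -/
def flipRoundReads [DecidableEq V] (f : V × I → C) (v : V) : Finset (C ⊕ V) :=
  insert (Sum.inr v) (univ.biUnion fun i =>
    insert (Sum.inl (f (v, i))) (image (fun e => Sum.inr e.1) {e | f e = f (v, i)}))

theorem card_flipRoundReads_le [DecidableEq V] {f : V × I → C} {D : ℕ}
    (hf : ∀ c, #{e | f e = c} ≤ D) (v : V) :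
    #(flipRoundReads f v) ≤ Fintype.card I * (D + 1) + 1 := by
  refine (card_insert_le _ _).trans (Nat.succ_le_succ ?_)
  rw [← card_univ]
  exact card_biUnion_le_card_mul _ _ _ fun i _ =>
    (card_insert_le _ _).trans (Nat.succ_le_succ (card_image_le.trans (hf _)))

theorem dependsOn_flipRound [DecidableEq V] (f : V × I → C) (v : V) :
    DependsOn (fun y : C ⊕ V → ZMod 2 => flipRound f (y ∘ Sum.inl) (y ∘ Sum.inr) v)
      (flipRoundReads f v) := by
  intro x y h
  have hcheck (i : I) : ((x ∘ Sum.inl) + tannerMatrix f *ᵥ (x ∘ Sum.inr)) (f (v, i)) =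
      ((y ∘ Sum.inl) + tannerMatrix f *ᵥ (y ∘ Sum.inr)) (f (v, i)) := by
    have hread : ∀ z ∈ insert (Sum.inl (f (v, i)))
        (image (fun e => (Sum.inr e.1 : C ⊕ V)) {e | f e = f (v, i)}), x z = y z := fun z hz =>
      h z (mem_insert_of_mem (mem_biUnion.2 ⟨i, mem_univ _, hz⟩))
    rw [Pi.add_apply, Pi.add_apply, tannerMatrix_mulVec, tannerMatrix_mulVec]
    refine congrArg₂ _ (hread _ (mem_insert_self _ _)) (sum_congr rfl fun e he => ?_)
    exact hread _ (mem_insert_of_mem (mem_image_of_mem _ he))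
  have hv : x (Sum.inr v) = y (Sum.inr v) := h _ (mem_insert_self _ _)
  refine congrArg₂ (· + ·) hv ?_
  rw [flips, flips, unsatisfied, unsatisfied]
  simp_rw [hcheck]

theorem computes_flipDecode {I C : Type} [Fintype I] [DecidableEq C] {n D : ℕ} [NeZero n]
    {f : Fin n × I → C}
    (hf : ∀ c, #{e | f e = c} ≤ D) (k : ℕ) :
    Computes n (4 ^ (Fintype.card I * (D + 1) + 2) * (k + 1)) (flipDecode f k) := by
  classical
  set L := 4 ^ (Fintype.card I * (D + 1) + 2)
  have hround : Computes n L (fun (y : C ⊕ Fin n → ZMod 2) =>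
      flipRound f (y ∘ Sum.inl) (y ∘ Sum.inr)) :=
    Computes.pi_unit fun v => (Computes.of_dependsOn _ (dependsOn_flipRound f v)).mono
      (Nat.pow_le_pow_right (by norm_num) (Nat.succ_le_succ (card_flipRoundReads_le hf v)))
  have hkeep : Computes n L (fun (y : C ⊕ Fin n → ZMod 2) =>
      Sum.elim (y ∘ Sum.inl) (flipRound f (y ∘ Sum.inl) (y ∘ Sum.inr))) :=
    (hround.keep.postproj (Sum.elim (Sum.inl ∘ Sum.inl) Sum.inr)).congr
      (by rintro y (c | v) <;> rfl)
  have hrounds (k : ℕ) : Computes n (L * (k + 1))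
      (fun s : C → ZMod 2 => Sum.elim s (flipDecode f k s)) := by
    induction k with
    | zero => exact (Computes.const (κ := Fin n) 0).keep.mono (Nat.mul_pos (by positivity) one_pos)
    | succ k ih =>
      refine ((hkeep.comp ih).congr ?_).mono (le_of_eq (by ring))
      rintro s (c | v)
      · rfl
      · exact (congrFun (Function.iterate_succ_apply' (flipRound f s) k 0) v).symm
  exact (hrounds k).postproj Sum.inr

end BitFlipping

section Matrix

variable {K m m' n : Type*} [Field K] [Fintype m] [Fintype m'] [Fintype n]

theorem card_le_finrank_ker_mulVecLin_add (H : Matrix m n K) :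
    Fintype.card n ≤ Module.finrank K (LinearMap.ker H.mulVecLin) + Fintype.card m := by
  have hnullity := LinearMap.finrank_range_add_finrank_ker H.mulVecLin
  have hrank : H.rank ≤ Fintype.card m := H.rank_le_card_height
  rw [Module.finrank_fintype_fun_eq_card] at hnullity
  rw [Matrix.rank] at hrank
  omega

theorem exists_mulVec_eq_zero_notMem_span_rows (H : Matrix m n K) (G : Matrix m' n K)
    (h : Fintype.card m + Fintype.card m' < Fintype.card n) :
    ∃ v, H *ᵥ v = 0 ∧ v ∉ Submodule.span K (Set.range G) := by
  by_contra! hc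
  have hle : LinearMap.ker H.mulVecLin ≤ Submodule.span K (Set.range G) := hc
  have hfinrank := Submodule.finrank_mono hle
  have hker := card_le_finrank_ker_mulVecLin_add H
  have hspan : Module.finrank K (Submodule.span K (Set.range G)) ≤ Fintype.card m' :=
    finrank_range_le_card G
  omega

end Matrix

namespace CSSCode

variable {N : ℕ} (Q : CSSCode N)

theorem neg_one_pow_val_add (a b : ZMod 2) :
    (-1 : ℂ) ^ (a + b).val = (-1) ^ a.val * (-1) ^ b.val := by
  rw [ZMod.val_add, ← neg_one_pow_eq_pow_mod_two, pow_add]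

theorem zStab_mulVec_eq_zero_of_apply_ne_zero {ψ : QState N} (hψ : ψ ∈ Q.codeSpace) {a : Bits N}
    (ha : ψ a ≠ 0) : Q.zStab *ᵥ a = 0 := by
  funext j
  have hfixed : (-1 : ℂ) ^ (Q.zStab j ⬝ᵥ a).val * ψ a = ψ a := congrFun (hψ.2 j) a
  have hsign : (-1 : ℂ) ^ (Q.zStab j ⬝ᵥ a).val = 1 := (mul_eq_right₀ ha).1 hfixed
  by_contra h
  rw [zmod_two_eq_one_of_ne_zero (b := Q.zStab j ⬝ᵥ a) h, ZMod.val_one] at hsign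
  norm_num at hsign

theorem corrects_of_eq {D : Q.Syndrome → (Fin N ⊕ Fin N → ZMod 2)} {u v : Bits N}
    (hu : D (Q.syndrome u v) ∘ Sum.inl = u)
    (hv : ∀ a, Q.zStab *ᵥ a = 0 → (D (Q.syndrome u v) ∘ Sum.inr + v) ⬝ᵥ a = 0) :
    Q.Corrects D u v := by
  set v' : Bits N := D (Q.syndrome u v) ∘ Sum.inr
  refine ⟨(-1) ^ (v' ⬝ᵥ u).val, by simp, fun ψ hψ => ?_⟩
  change pauliX (D (Q.syndrome u v) ∘ Sum.inl) (pauliZ v' _) = _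
  rw [hu]
  funext a
  change (-1 : ℂ) ^ (v' ⬝ᵥ (a - u)).val * ((-1) ^ (v ⬝ᵥ (a - u - u)).val * ψ (a - u - u)) =
    (-1) ^ (v' ⬝ᵥ u).val * ψ a
  have hsub : a - u = a + u := funext fun i => CharTwo.sub_eq_add _ _
  have hsub_sub : a - u - u = a := by
    rw [hsub, add_sub_cancel_right]
  rw [hsub_sub, hsub, dotProduct_add, neg_one_pow_val_add]
  by_cases h0 : ψ a = 0
  · simp [h0]
  · have hsign : (-1 : ℂ) ^ (v' ⬝ᵥ a).val * (-1) ^ (v ⬝ᵥ a).val = 1 := by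
      rw [← neg_one_pow_val_add, ← add_dotProduct,
        hv a (Q.zStab_mulVec_eq_zero_of_apply_ne_zero hψ h0), ZMod.val_zero, pow_zero]
    linear_combination (-1 : ℂ) ^ (v' ⬝ᵥ u).val * ψ a * hsign

/-- The vectors that satisfy all `Z`-checks. The code states are supported on them. -/
def zKer : Submodule (ZMod 2) (Bits N) := LinearMap.ker Q.zStab.mulVecLin

/-- The span of the rows of `xStab`. The code states are invariant under translation by it. -/
def xSpan : Submodule (ZMod 2) (Bits N) := Submodule.span (ZMod 2) (Set.range Q.xStab)

theorem xStab_mem_zKer (i : Fin Q.rX) : Q.xStab i ∈ Q.zKer := by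
  funext j
  have hcomm := congrFun (congrFun Q.comm i) j
  rw [Matrix.mul_apply'] at hcomm
  rw [Pi.zero_apply, Matrix.mulVecLin_apply, Matrix.mulVec, dotProduct_comm]
  exact hcomm

theorem apply_sub_of_mem_xSpan {ψ : QState N} (hψ : ψ ∈ Q.codeSpace) {w : Bits N}
    (hw : w ∈ Q.xSpan) : ∀ a, ψ (a - w) = ψ a := by
  induction hw using Submodule.span_induction with
  | mem w hw =>
    obtain ⟨i, rfl⟩ := hw
    exact fun a => congrFun (hψ.1 i) a
  | zero => simp
  | add w w' _ _ h h' =>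
    intro a
    rw [← sub_sub, h', h]
  | smul c w _ h =>
    intro a
    by_cases hc : c = 0
    · rw [hc, zero_smul, sub_zero]
    · rw [zmod_two_eq_one_of_ne_zero hc, one_smul, h]

open Classical in
/-- The identification of the code states with the functions on `zKer / xSpan`. -/
noncomputable def cosetState : (Q.zKer ⧸ Q.xSpan.submoduleOf Q.zKer → ℂ) →ₗ[ℂ] QState N where
  toFun φ := fun a => if h : a ∈ Q.zKer then φ (Submodule.Quotient.mk ⟨a, h⟩) else 0
  map_add' φ φ' := by
    funext a
    by_cases h : a ∈ Q.zKer <;> simp [h]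
  map_smul' c φ := by
    funext a
    by_cases h : a ∈ Q.zKer <;> simp [h]

variable {Q} in
theorem cosetState_apply_of_mem (φ : Q.zKer ⧸ Q.xSpan.submoduleOf Q.zKer → ℂ) {a : Bits N}
    (h : a ∈ Q.zKer) : Q.cosetState φ a = φ (Submodule.Quotient.mk ⟨a, h⟩) := dif_pos h

variable {Q} in
theorem cosetState_apply_of_notMem (φ : Q.zKer ⧸ Q.xSpan.submoduleOf Q.zKer → ℂ) {a : Bits N}
    (h : a ∉ Q.zKer) : Q.cosetState φ a = 0 := dif_neg h

theorem cosetState_injective : Function.Injective Q.cosetState := by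
  intro φ φ' h
  funext q
  obtain ⟨⟨a, ha⟩, rfl⟩ := Submodule.Quotient.mk_surjective _ q
  rw [← cosetState_apply_of_mem φ ha, h, cosetState_apply_of_mem φ' ha]

variable {Q} in
theorem cosetState_mem_codeSpace (φ : Q.zKer ⧸ Q.xSpan.submoduleOf Q.zKer → ℂ) :
    Q.cosetState φ ∈ Q.codeSpace := by
  refine ⟨fun i => funext fun a => ?_, fun j => funext fun a => ?_⟩
  · change Q.cosetState φ (a - Q.xStab i) = Q.cosetState φ a
    have hiff : a - Q.xStab i ∈ Q.zKer ↔ a ∈ Q.zKer :=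
      Submodule.sub_mem_iff_left _ (Q.xStab_mem_zKer i)
    by_cases h : a ∈ Q.zKer
    · rw [cosetState_apply_of_mem φ h, cosetState_apply_of_mem φ (hiff.2 h)]
      refine congrArg φ ((Submodule.Quotient.eq _).2 ?_)
      change a - Q.xStab i - a ∈ Q.xSpan
      rw [sub_sub_cancel_left]
      exact Submodule.neg_mem _ (Submodule.subset_span ⟨i, rfl⟩)
    · rw [cosetState_apply_of_notMem φ h, cosetState_apply_of_notMem φ (mt hiff.1 h)]
  · change (-1 : ℂ) ^ (Q.zStab j ⬝ᵥ a).val * Q.cosetState φ a = Q.cosetState φ a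
    by_cases h : a ∈ Q.zKer
    · have hcheck : Q.zStab j ⬝ᵥ a = 0 := congrFun (LinearMap.mem_ker.1 h) j
      rw [hcheck, ZMod.val_zero, pow_zero, one_mul]
    · rw [cosetState_apply_of_notMem φ h, mul_zero]

theorem exists_cosetState_eq {ψ : QState N} (hψ : ψ ∈ Q.codeSpace) :
    ∃ φ, Q.cosetState φ = ψ := by
  refine ⟨fun q => ψ (Quotient.out q).1, funext fun a => ?_⟩
  by_cases h : a ∈ Q.zKer
  · rw [cosetState_apply_of_mem _ h]
    set b := Quotient.out (Submodule.Quotient.mk ⟨a, h⟩ : Q.zKer ⧸ Q.xSpan.submoduleOf Q.zKer)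
    have hmk : (Submodule.Quotient.mk b : Q.zKer ⧸ Q.xSpan.submoduleOf Q.zKer) =
        Submodule.Quotient.mk ⟨a, h⟩ := Quotient.out_eq _
    have hdiff : b - ⟨a, h⟩ ∈ Q.xSpan.submoduleOf Q.zKer := (Submodule.Quotient.eq _).1 hmk
    rw [← Q.apply_sub_of_mem_xSpan hψ (w := b.1 - a) hdiff, sub_sub_cancel]
  · rw [cosetState_apply_of_notMem _ h]
    by_contra h0
    exact h (Q.zStab_mulVec_eq_zero_of_apply_ne_zero hψ (Ne.symm h0))

theorem range_cosetState : LinearMap.range Q.cosetState = Q.codeSpace :=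
  le_antisymm (LinearMap.range_le_iff_comap.2 (eq_top_iff.2 fun φ _ => cosetState_mem_codeSpace φ))
    fun _ hψ => Q.exists_cosetState_eq hψ

/-- The number of logical qubits. -/
noncomputable def logicalDim : ℕ :=
  Module.finrank (ZMod 2) (Q.zKer ⧸ Q.xSpan.submoduleOf Q.zKer)

theorem finrank_codeSpace : Module.finrank ℂ Q.codeSpace = 2 ^ Q.logicalDim := by
  classical
  have : Fintype (Q.zKer ⧸ Q.xSpan.submoduleOf Q.zKer) := Fintype.ofFinite _
  rw [← range_cosetState, LinearMap.finrank_range_of_inj Q.cosetState_injective,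
    Module.finrank_fintype_fun_eq_card, Module.card_eq_pow_finrank (K := ZMod 2), ZMod.card,
    logicalDim]

theorem le_logicalDim : N ≤ Q.logicalDim + Q.rX + Q.rZ := by
  have hquotient := Submodule.finrank_quotient_add_finrank (Q.xSpan.submoduleOf Q.zKer)
  have hker : N ≤ Module.finrank (ZMod 2) Q.zKer + Q.rZ :=
    (Fintype.card_fin N).ge.trans
      ((card_le_finrank_ker_mulVecLin_add Q.zStab).trans_eq (by rw [Fintype.card_fin, zKer]))
  have hspan : Module.finrank (ZMod 2) Q.xSpan ≤ Q.rX :=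
    (finrank_range_le_card Q.xStab).trans_eq (Fintype.card_fin _)
  have hsub : Module.finrank (ZMod 2) (Q.xSpan.submoduleOf Q.zKer) ≤
      Module.finrank (ZMod 2) Q.xSpan := by
    rw [← Submodule.finrank_map_subtype_eq]
    exact Submodule.finrank_mono (Submodule.map_comap_le _ _)
  rw [logicalDim]
  omega

theorem le_distZ {w : ℕ} (h : Q.rX + Q.rZ < N) (hw : ∀ v : Bits N, Q.xStab *ᵥ v = 0 →
    v ∉ Submodule.span (ZMod 2) (Set.range Q.zStab) → w ≤ hammingNorm v) : w ≤ Q.distZ := by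
  obtain ⟨v, hv, hv'⟩ := exists_mulVec_eq_zero_notMem_span_rows Q.xStab Q.zStab (by simpa using h)
  refine le_csInf ⟨_, v, hv, hv', rfl⟩ ?_
  rintro _ ⟨v, hv, hv', rfl⟩
  exact hw v hv hv'

theorem le_distX {w : ℕ} (h : Q.rX + Q.rZ < N) (hw : ∀ u : Bits N, Q.zStab *ᵥ u = 0 →
    u ∉ Submodule.span (ZMod 2) (Set.range Q.xStab) → w ≤ hammingNorm u) : w ≤ Q.distX := by
  obtain ⟨u, hu, hu'⟩ := exists_mulVec_eq_zero_notMem_span_rows Q.zStab Q.xStab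
    (by simpa [add_comm] using h)
  refine le_csInf ⟨_, u, hu, hu', rfl⟩ ?_
  rintro _ ⟨u, hu, hu', rfl⟩
  exact hw u hu hu'

end CSSCode

section Concatenation

variable {n m q R : ℕ}

/-- The block `b` of a word that is the concatenation of `n` blocks of length `m`. -/
def block (u : Bits (n * m)) (b : Fin n) : Bits m :=
  fun l => u (finProdFinEquiv (b, l))

/-- The parities of the blocks of a word. -/
def blockParity (u : Bits (n * m)) : Bits n :=
  fun b => ∑ l, block u b l

theorem hammingNorm_blockParity_le (u : Bits (n * m)) :
    hammingNorm (blockParity u) ≤ hammingNorm u := by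
  refine Finset.card_le_card_of_surjOn (fun j => (finProdFinEquiv.symm j).1) fun b hb => ?_
  obtain ⟨l, -, hl⟩ := Finset.exists_ne_zero_of_sum_ne_zero (Finset.mem_filter.1 hb).2
  exact ⟨finProdFinEquiv (b, l), Finset.mem_coe.2 (Finset.mem_filter.2 ⟨Finset.mem_univ _, hl⟩),
    by simp only [Equiv.symm_apply_apply]⟩

theorem sum_eq_sum_blocks {A : Type*} [AddCommMonoid A] (F : Fin (n * m) → A) :
    ∑ j, F j = ∑ b, ∑ l, F (finProdFinEquiv (b, l)) := by
  rw [← Equiv.sum_comp finProdFinEquiv, Fintype.sum_prod_type]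

/-- The check of the repetition code that compares bit `i + 1` of the block `b` with bit `0`. -/
def starCheck (b : Fin n) (i : Fin q) : Bits (n * (q + 1)) :=
  Pi.single (finProdFinEquiv (b, 0)) 1 + Pi.single (finProdFinEquiv (b, i.succ)) 1

theorem starCheck_dotProduct (b : Fin n) (i : Fin q) (u : Bits (n * (q + 1))) :
    starCheck b i ⬝ᵥ u = block u b 0 + block u b i.succ := by
  rw [starCheck, add_dotProduct, single_one_dotProduct, single_one_dotProduct, block, block]

theorem mem_span_starCheck {v : Bits (n * (q + 1))} (hv : blockParity v = 0) :
    v ∈ Submodule.span (ZMod 2) (Set.range fun s : Fin n × Fin q => starCheck s.1 s.2) := by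
  set e : Fin n → Fin (q + 1) → Bits (n * (q + 1)) := fun b l =>
    Pi.single (finProdFinEquiv (b, l)) 1
  have hbasis : v = ∑ b, ∑ l, block v b l • e b l :=
    (pi_eq_sum_univ' v).trans (sum_eq_sum_blocks _)
  have hparity : ∀ b, ∑ l, block v b l • e b 0 = 0 := fun b => by
    rw [← Finset.sum_smul, show ∑ l, block v b l = 0 from congrFun hv b, zero_smul]
  have hpairs : v = ∑ b, ∑ l, block v b l • (e b 0 + e b l) := by
    simp only [smul_add, Finset.sum_add_distrib, hparity, zero_add]
    exact hbasis
  rw [hpairs]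
  refine Submodule.sum_mem _ fun b _ => Submodule.sum_mem _ fun l _ => Submodule.smul_mem _ _ ?_
  rcases Fin.eq_zero_or_eq_succ l with rfl | ⟨i, rfl⟩
  · have hzero : e b 0 + e b 0 = 0 := funext fun j => CharTwo.add_self_eq_zero _
    rw [hzero]
    exact Submodule.zero_mem _
  · exact Submodule.subset_span ⟨(b, i), rfl⟩

/-- The concatenation of the classical code with the parity-check matrix `H`, which protects against
`Z`-errors, with the repetition code of length `q + 1`, which protects against `X`-errors. -/
def concatCode (H : Matrix (Fin R) (Fin n) (ZMod 2)) (q : ℕ) : CSSCode (n * (q + 1)) where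
  rX := R
  rZ := n * q
  xStab := Matrix.of fun c j => H c (finProdFinEquiv.symm j).1
  zStab := Matrix.of fun s => starCheck (finProdFinEquiv.symm s).1 (finProdFinEquiv.symm s).2
  comm := by
    ext c s
    rw [Matrix.mul_apply', dotProduct_comm]
    refine (starCheck_dotProduct _ _ _).trans ?_
    simp only [block, Matrix.of_apply, Equiv.symm_apply_apply]
    exact CharTwo.add_self_eq_zero _

variable (H : Matrix (Fin R) (Fin n) (ZMod 2))

theorem concatCode_zStab_mulVec (u : Bits (n * (q + 1))) (b : Fin n) (i : Fin q) :
    ((concatCode H q).zStab *ᵥ u) (finProdFinEquiv (b, i)) = block u b 0 + block u b i.succ := by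
  refine (starCheck_dotProduct _ _ _).trans ?_
  rw [Equiv.symm_apply_apply]

theorem concatCode_xStab_mulVec (v : Bits (n * (q + 1))) :
    (concatCode H q).xStab *ᵥ v = H *ᵥ blockParity v := by
  funext c
  change ∑ j, H c (finProdFinEquiv.symm j).1 * v j = ∑ b, H c b * blockParity v b
  rw [sum_eq_sum_blocks]
  simp only [Equiv.symm_apply_apply, blockParity, block, Finset.mul_sum]

theorem block_eq_of_concatCode_zStab_mulVec_eq_zero {u : Bits (n * (q + 1))}
    (hu : (concatCode H q).zStab *ᵥ u = 0) (b : Fin n) (l : Fin (q + 1)) :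
    block u b l = block u b 0 := by
  rcases Fin.eq_zero_or_eq_succ l with rfl | ⟨i, rfl⟩
  · rfl
  · exact (CharTwo.add_eq_zero.1
      ((concatCode_zStab_mulVec H u b i).symm.trans (congrFun hu _))).symm

theorem dotProduct_eq_zero_of_blockParity_eq_zero {w u : Bits (n * (q + 1))}
    (hw : blockParity w = 0) (hu : (concatCode H q).zStab *ᵥ u = 0) : w ⬝ᵥ u = 0 := by
  rw [dotProduct, sum_eq_sum_blocks]
  refine Finset.sum_eq_zero fun b _ => ?_
  calc ∑ l, block w b l * block u b l = ∑ l, block w b l * block u b 0 :=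
        Finset.sum_congr rfl fun l _ => by
          rw [block_eq_of_concatCode_zStab_mulVec_eq_zero H hu]
    _ = blockParity w b * block u b 0 := by rw [← Finset.sum_mul, blockParity]
    _ = 0 := by rw [hw, Pi.zero_apply, zero_mul]

theorem mem_span_zStab_concatCode {v : Bits (n * (q + 1))} (hv : blockParity v = 0) :
    v ∈ Submodule.span (ZMod 2) (Set.range (concatCode H q).zStab) := by
  refine Submodule.span_mono ?_ (mem_span_starCheck hv)
  rintro _ ⟨s, rfl⟩
  refine ⟨finProdFinEquiv s, ?_⟩
  change starCheck (finProdFinEquiv.symm (finProdFinEquiv s)).1 _ = _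
  rw [Equiv.symm_apply_apply]

theorem le_distX_concatCode (hr : R + n * q < n * (q + 1)) : q + 1 ≤ (concatCode H q).distX := by
  refine CSSCode.le_distX _ hr fun u hu hspan => ?_
  have hu0 : u ≠ 0 := fun h => hspan (h ▸ Submodule.zero_mem _)
  obtain ⟨j, hj⟩ := Function.ne_iff.1 hu0
  obtain ⟨⟨b, l⟩, rfl⟩ := finProdFinEquiv.surjective j
  have hb0 : block u b 0 ≠ 0 := by
    rwa [← block_eq_of_concatCode_zStab_mulVec_eq_zero H hu b l]
  calc q + 1 = (Finset.univ : Finset (Fin (q + 1))).card := by simp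
    _ ≤ hammingNorm u := Finset.card_le_card_of_injOn (fun l' => finProdFinEquiv (b, l'))
        (fun l' _ => Finset.mem_coe.2 (Finset.mem_filter.2 ⟨Finset.mem_univ _,
          (block_eq_of_concatCode_zStab_mulVec_eq_zero H hu b l').trans_ne hb0⟩))
        (fun l' _ l'' _ h => (Prod.mk.inj (finProdFinEquiv.injective h)).2)

theorem le_distZ_concatCode (hr : R + n * q < n * (q + 1)) {d : ℕ}
    (hH : ∀ e, H *ᵥ e = 0 → hammingNorm e < d → e = 0) : d ≤ (concatCode H q).distZ := by
  refine CSSCode.le_distZ _ hr fun v hv hspan => not_lt.1 fun hlt => hspan ?_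
  exact mem_span_zStab_concatCode H (hH _ ((concatCode_xStab_mulVec H v).symm.trans hv)
    ((hammingNorm_blockParity_le v).trans_lt hlt))

/-- The decoder of the concatenated code that decodes every block by `g` and the outer code by
`φ`. The outer code corrects a block by a `Z`-operator on its bit `0`. -/
def concatDecode (g : (Fin q → ZMod 2) → Fin (q + 1) → ZMod 2)
    (φ : (Fin R → ZMod 2) → Fin n → ZMod 2) (s : (concatCode H q).Syndrome) :
    Fin (n * (q + 1)) ⊕ Fin (n * (q + 1)) → ZMod 2 :=
  Sum.elim
    (fun j => g (block (s ∘ Sum.inr) (finProdFinEquiv.symm j).1) (finProdFinEquiv.symm j).2)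
    (fun j => if (finProdFinEquiv.symm j).2 = 0
      then φ (s ∘ Sum.inl) (finProdFinEquiv.symm j).1 else 0)

variable {g : (Fin q → ZMod 2) → Fin (q + 1) → ZMod 2} {φ : (Fin R → ZMod 2) → Fin n → ZMod 2}

theorem blockParity_concatDecode (s : (concatCode H q).Syndrome) :
    blockParity (concatDecode H g φ s ∘ Sum.inr) = φ (s ∘ Sum.inl) := by
  funext b
  simp only [blockParity, block, Function.comp_apply, concatDecode, Sum.elim_inr,
    Equiv.symm_apply_apply, Finset.sum_ite_eq', Finset.mem_univ, if_true]

theorem corrects_concatDecode {u v : Bits (n * (q + 1))}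
    (hu : ∀ b, g (fun i => block u b 0 + block u b i.succ) = block u b)
    (hv : φ (H *ᵥ blockParity v) = blockParity v) :
    (concatCode H q).Corrects (concatDecode H g φ) u v := by
  refine CSSCode.corrects_of_eq _ ?_ fun a ha => dotProduct_eq_zero_of_blockParity_eq_zero H ?_ ha
  · funext j
    obtain ⟨⟨b, l⟩, rfl⟩ := finProdFinEquiv.surjective j
    have hblock : block (n := n) ((concatCode H q).syndrome u v ∘ Sum.inr) b =
        fun i => block u b 0 + block u b i.succ :=
      funext fun i => concatCode_zStab_mulVec H u b i
    simp only [concatDecode, Function.comp_apply, Sum.elim_inl, Equiv.symm_apply_apply]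
    rw [hblock, hu]
    rfl
  · have hsyndrome : (concatCode H q).syndrome u v ∘ Sum.inl = H *ᵥ blockParity v :=
      concatCode_xStab_mulVec H v
    have hparity : blockParity (concatDecode H g φ ((concatCode H q).syndrome u v) ∘ Sum.inr) =
        blockParity v :=
      (blockParity_concatDecode H _).trans ((congrArg φ hsyndrome).trans hv)
    funext b
    refine (Finset.sum_add_distrib.trans (congrArg (· + _) (congrFun hparity b))).trans ?_
    exact CharTwo.add_self_eq_zero _

theorem computes_concatDecode [NeZero n] {T₁ T₂ : ℕ} (hg : Computes 1 T₁ g)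
    (hφ : Computes n T₂ φ) : Computes n (T₁ + (T₂ + 1)) (concatDecode H g φ) := by
  have hinner := (Computes.pi (P := n) fun b => hg.preproj
    (fun i => (Sum.inr (finProdFinEquiv (b, i)) : Fin R ⊕ Fin (n * q)))).postproj
    (fun j : Fin (n * (q + 1)) => ⟨(finProdFinEquiv.symm j).1, (finProdFinEquiv.symm j).2⟩)
  have houter := ((hφ.preproj (Sum.inl : Fin R → Fin R ⊕ Fin (n * q))).pair
    (Computes.const (κ := Unit) 0)).postproj (fun j : Fin (n * (q + 1)) =>
      if (finProdFinEquiv.symm j).2 = 0 then Sum.inl (finProdFinEquiv.symm j).1 else Sum.inr ())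
  refine (hinner.pair houter).congr ?_
  rintro s (j | j)
  · rfl
  · simp only [concatDecode, Sum.elim_inr]
    split_ifs <;> rfl

end Concatenation

section Bernoulli

open Finset

/-- The probability that a bit that is equal to `1` with probability `p` has the value `b`. -/
def bernoulliWeight (p : ℝ) (b : ZMod 2) : ℝ :=
  if b = 0 then 1 - p else p

variable {ι : Type*} {N n m h : ℕ} {p : ℝ}

theorem bernoulliWeight_nonneg (h0 : 0 ≤ p) (h1 : p ≤ 1) (b : ZMod 2) :
    0 ≤ bernoulliWeight p b := by
  unfold bernoulliWeight
  split_ifs <;> linarith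

theorem sum_bernoulliWeight (p : ℝ) : ∑ b, bernoulliWeight p b = 1 := by
  have huniv : (univ : Finset (ZMod 2)) = {0, 1} := rfl
  simp [huniv, bernoulliWeight]

theorem prod_bernoulliWeight (p : ℝ) (u : Bits N) :
    ∏ j, bernoulliWeight p (u j) = p ^ hammingNorm u * (1 - p) ^ (N - hammingNorm u) := by
  have hcard : #{j | u j = 0} = N - hammingNorm u := by
    have := card_filter_add_card_filter_not (s := (univ : Finset (Fin N))) (fun j => u j = 0)
    rw [card_univ, Fintype.card_fin] at this
    exact Nat.eq_sub_of_add_eq this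
  simp only [bernoulliWeight]
  rw [prod_ite, prod_const, prod_const, hcard, mul_comm]
  rfl

theorem bernoulliProb_eq_sum_prod (p : ℝ) (S : Set (Bits N)) :
    bernoulliProb p S = ∑ u, S.indicator (fun u => ∏ j, bernoulliWeight p (u j)) u := by
  simp only [prod_bernoulliWeight, bernoulliProb]

theorem bernoulliProb_nonneg (h0 : 0 ≤ p) (h1 : p ≤ 1) (S : Set (Bits N)) :
    0 ≤ bernoulliProb p S := by
  rw [bernoulliProb_eq_sum_prod]
  exact sum_nonneg fun _ _ => Set.indicator_nonneg
    (fun _ _ => prod_nonneg fun _ _ => bernoulliWeight_nonneg h0 h1 _) _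

theorem bernoulliProb_mono (h0 : 0 ≤ p) (h1 : p ≤ 1) {S S' : Set (Bits N)} (h : S ⊆ S') :
    bernoulliProb p S ≤ bernoulliProb p S' := by
  rw [bernoulliProb_eq_sum_prod, bernoulliProb_eq_sum_prod]
  exact sum_le_sum fun _ _ => Set.indicator_le_indicator_of_subset h
    (fun _ => prod_nonneg fun _ _ => bernoulliWeight_nonneg h0 h1 _) _

theorem bernoulliProb_univ (p : ℝ) : bernoulliProb p (Set.univ : Set (Bits N)) = 1 := by
  rw [bernoulliProb_eq_sum_prod]
  simp only [Set.indicator_univ]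
  rw [← Fintype.piFinset_univ, ← prod_univ_sum]
  exact prod_eq_one fun _ _ => sum_bernoulliWeight p

theorem bernoulliProb_exists_le [Fintype ι] (h0 : 0 ≤ p) (h1 : p ≤ 1) (S : ι → Set (Bits N)) :
    bernoulliProb p {u | ∃ i, u ∈ S i} ≤ ∑ i, bernoulliProb p (S i) := by
  simp only [bernoulliProb_eq_sum_prod]
  rw [sum_comm]
  have hweight : ∀ u : Bits N, 0 ≤ ∏ j, bernoulliWeight p (u j) := fun u =>
    prod_nonneg fun _ _ => bernoulliWeight_nonneg h0 h1 _
  have hnonneg : ∀ i (u : Bits N), 0 ≤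
      (S i).indicator (fun u => ∏ j, bernoulliWeight p (u j)) u := fun i u =>
    Set.indicator_nonneg (fun u _ => hweight u) u
  refine sum_le_sum fun u _ => Set.indicator_apply_le' ?_ fun _ => sum_nonneg fun i _ => hnonneg i u
  rintro ⟨i, hi⟩
  rw [← Set.indicator_of_mem hi fun u : Bits N => ∏ j, bernoulliWeight p (u j)]
  exact single_le_sum (fun i _ => hnonneg i u) (mem_univ i)

theorem bernoulliProb_forall_block (p : ℝ) (A : Fin n → Set (Bits m)) :
    bernoulliProb p {u : Bits (n * m) | ∀ b, block u b ∈ A b} = ∏ b, bernoulliProb p (A b) := by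
  classical
  let blocks : Bits (n * m) ≃ (Fin n → Bits m) :=
    (Equiv.arrowCongr finProdFinEquiv.symm (Equiv.refl _)).trans (Equiv.curry _ _ _)
  simp only [bernoulliProb_eq_sum_prod]
  rw [prod_univ_sum, Fintype.piFinset_univ, ← Equiv.sum_comp blocks]
  refine sum_congr rfl fun u _ => ?_
  have hprod : ∏ j, bernoulliWeight p (u j) = ∏ b, ∏ l, bernoulliWeight p (block u b l) := by
    rw [← Equiv.prod_comp finProdFinEquiv, Fintype.prod_prod_type]
    rfl
  by_cases hu : ∀ b, block u b ∈ A b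
  · rw [Set.indicator_of_mem (by exact hu), hprod]
    exact prod_congr rfl fun b _ =>
      (Set.indicator_of_mem (hu b) fun x => ∏ l, bernoulliWeight p (x l)).symm
  · obtain ⟨b, hb⟩ := not_forall.1 hu
    rw [Set.indicator_of_notMem (by exact hu)]
    exact (prod_eq_zero (mem_univ b) (Set.indicator_of_notMem hb _)).symm

theorem bernoulliProb_block (p : ℝ) (b : Fin n) (A : Set (Bits m)) :
    bernoulliProb p {u : Bits (n * m) | block u b ∈ A} = bernoulliProb p A := by
  have hset : {u : Bits (n * m) | block u b ∈ A} =
      {u | ∀ b', block u b' ∈ Function.update (fun _ => Set.univ) b A b'} := by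
    ext u
    refine ⟨fun hu b' => ?_, fun hu => by simpa using hu b⟩
    by_cases hb : b' = b
    · subst hb
      simpa using hu
    · simp [Function.update_of_ne hb]
  rw [hset, bernoulliProb_forall_block, ← mul_prod_erase univ _ (mem_univ b),
    Function.update_self, prod_eq_one, mul_one]
  intro b' hb'
  rw [Function.update_of_ne (ne_of_mem_erase hb'), bernoulliProb_univ]

theorem pow_mul_one_sub_pow_le (h0 : 0 ≤ p) (h1 : p ≤ 1 / 2) {w : ℕ} (hw : h < w)
    (hw' : w ≤ 2 * h + 1) : p ^ w * (1 - p) ^ (2 * h + 1 - w) ≤ (p * (1 - p)) ^ h / 2 := by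
  obtain ⟨d, rfl⟩ := Nat.exists_eq_add_of_le hw
  obtain ⟨e, rfl⟩ : ∃ e, h = d + e := Nat.exists_eq_add_of_le (by omega)
  have hq : 0 ≤ 1 - p := by linarith
  calc p ^ (d + e + 1 + d) * (1 - p) ^ (2 * (d + e) + 1 - (d + e + 1 + d))
      = p ^ (d + e) * p ^ d * (1 - p) ^ e * p := by
        rw [show 2 * (d + e) + 1 - (d + e + 1 + d) = e by omega]
        ring
    _ ≤ p ^ (d + e) * (1 - p) ^ d * (1 - p) ^ e * (1 / 2) := by
        gcongr
        linarith
    _ = (p * (1 - p)) ^ (d + e) / 2 := by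
        rw [mul_pow, pow_add (1 - p)]
        ring

theorem bernoulliProb_lt_hammingNorm_le (h0 : 0 ≤ p) (h1 : p ≤ 1 / 2) :
    bernoulliProb p {u : Bits (2 * h + 1) | h < hammingNorm u} ≤ (4 * p * (1 - p)) ^ h := by
  have hq : 0 ≤ 1 - p := by linarith
  calc bernoulliProb p {u : Bits (2 * h + 1) | h < hammingNorm u}
      ≤ ∑ _u : Bits (2 * h + 1), (p * (1 - p)) ^ h / 2 := by
        refine sum_le_sum fun u _ => Set.indicator_apply_le' (fun hu => ?_) fun _ => by positivity
        exact pow_mul_one_sub_pow_le h0 h1 hu (by simpa using hammingNorm_le_card_fintype (x := u))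
    _ = 2 ^ (2 * h + 1) * ((p * (1 - p)) ^ h / 2) := by simp
    _ = (4 * p * (1 - p)) ^ h := by
        rw [pow_succ, pow_mul, mul_assoc 4, mul_pow 4]
        norm_num
        ring

theorem bernoulliProb_exists_block_lt_hammingNorm_le (h0 : 0 ≤ p) (h1 : p ≤ 1 / 2) :
    bernoulliProb p {u : Bits (n * (2 * h + 1)) | ∃ b, h < hammingNorm (block u b)} ≤
      n * (4 * p * (1 - p)) ^ h := by
  refine (bernoulliProb_exists_le h0 (by linarith) fun b =>
    {u | h < hammingNorm (block u b)}).trans ?_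
  calc ∑ b : Fin n, bernoulliProb p {u : Bits (n * (2 * h + 1)) | h < hammingNorm (block u b)}
      ≤ ∑ _b : Fin n, (4 * p * (1 - p)) ^ h := sum_le_sum fun b _ =>
        (bernoulliProb_block p b {x | h < hammingNorm x}).trans_le
          (bernoulliProb_lt_hammingNorm_le h0 h1)
    _ = n * (4 * p * (1 - p)) ^ h := by simp

end Bernoulli

/-- The length of the `i`-th code: an outer code of length `4 * 2 ^ 2 ^ i` is concatenated with the
repetition code of length `2 * 2 ^ (i + 7) + 1`. With the factor `2 ^ 7` the failure probability
of one block beats both the number of blocks and `N ^ c`. -/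
def codeLength (i : ℕ) : ℕ := 4 * 2 ^ 2 ^ i * (2 * 2 ^ (i + 7) + 1)

theorem codeLength_strictMono : StrictMono codeLength := by
  refine strictMono_nat_of_lt_succ fun i => ?_
  have hexp : 2 ^ i < 2 ^ (i + 1) := Nat.pow_lt_pow_right (by norm_num) i.lt_succ_self
  have hout : 2 ^ 2 ^ i < 2 ^ 2 ^ (i + 1) := Nat.pow_lt_pow_right (by norm_num) hexp
  have hin : 2 ^ (i + 7) < 2 ^ (i + 1 + 7) := Nat.pow_lt_pow_right (by norm_num) (by omega)
  exact Nat.mul_lt_mul'' (by omega) (by omega)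

theorem two_pow_mul_le_codeLength (i : ℕ) : 2 ^ i * (4 * 2 ^ 2 ^ i) ≤ codeLength i := by
  rw [codeLength, mul_comm, pow_add]
  exact Nat.mul_le_mul_left _ (by omega)

theorem le_codeLength (i : ℕ) : 4 * 2 ^ 2 ^ i ≤ codeLength i :=
  Nat.le_mul_of_pos_right _ (Nat.succ_pos _)

theorem two_le_codeLength (i : ℕ) : 2 ≤ codeLength i := by
  have := le_codeLength i
  have : 0 < 2 ^ 2 ^ i := by positivity
  omega

theorem codeLength_le_mul (i : ℕ) : codeLength i ≤ 2048 * 2 ^ i * 2 ^ 2 ^ i := by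
  have h : 2 * 2 ^ (i + 7) + 1 ≤ 512 * 2 ^ i := by
    have : 1 ≤ 2 ^ i := Nat.one_le_two_pow
    rw [pow_add]
    omega
  calc codeLength i ≤ 4 * 2 ^ 2 ^ i * (512 * 2 ^ i) := Nat.mul_le_mul_left _ h
    _ = 2048 * 2 ^ i * 2 ^ 2 ^ i := by ring

theorem codeLength_le_two_pow (i : ℕ) : codeLength i ≤ 2 ^ (12 * 2 ^ i) := by
  have hi : i < 2 ^ i := Nat.lt_two_pow_self
  calc codeLength i ≤ 2048 * 2 ^ i * 2 ^ 2 ^ i := codeLength_le_mul i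
    _ = 2 ^ (11 + i + 2 ^ i) := by rw [pow_add, pow_add]; norm_num
    _ ≤ 2 ^ (12 * 2 ^ i) := Nat.pow_le_pow_right (by norm_num) (by omega)

theorem log_codeLength_le (i : ℕ) : Real.log (codeLength i) ≤ 12 * 2 ^ i := by
  have hpos : (0 : ℝ) < codeLength i := by exact_mod_cast two_pos.trans_le (two_le_codeLength i)
  calc Real.log (codeLength i) ≤ Real.log (2 ^ (12 * 2 ^ i)) :=
        Real.log_le_log hpos (by exact_mod_cast codeLength_le_two_pow i)
    _ = 12 * 2 ^ i * Real.log 2 := by rw [Real.log_pow]; push_cast; rfl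
    _ ≤ 12 * 2 ^ i := mul_le_of_le_one_right (by positivity) (by linarith [Real.log_two_lt_d9])

theorem two_pow_le_log_codeLength (i : ℕ) : (2 : ℝ) ^ i ≤ 2 * Real.log (codeLength i) := by
  have hle : 2 ^ 2 ^ i ≤ codeLength i := le_trans (by omega) (le_codeLength i)
  calc (2 : ℝ) ^ i ≤ 2 ^ i * (2 * Real.log 2) :=
        le_mul_of_one_le_right (by positivity) (by linarith [Real.log_two_gt_d9])
    _ = 2 * Real.log (2 ^ 2 ^ i) := by rw [Real.log_pow]; push_cast; ring
    _ ≤ 2 * Real.log (codeLength i) := by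
        gcongr
        exact_mod_cast hle

theorem codeLength_div_log_le (i : ℕ) :
    codeLength i / Real.log (codeLength i) ≤ 4096 * 2 ^ 2 ^ i := by
  have hlog := two_pow_le_log_codeLength i
  have hpow : (0 : ℝ) < 2 ^ i := by positivity
  rw [div_le_iff₀ (by linarith)]
  calc (codeLength i : ℝ) ≤ 2048 * 2 ^ i * 2 ^ 2 ^ i := by exact_mod_cast codeLength_le_mul i
    _ ≤ 2048 * (2 * Real.log (codeLength i)) * 2 ^ 2 ^ i := by gcongr
    _ = 4096 * 2 ^ 2 ^ i * Real.log (codeLength i) := by ring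

theorem exists_pos_mul_codeLength_div_log_le {B : ℕ} (hB : 0 < B) :
    ∃ δ : ℝ, 0 < δ ∧ (∀ i, δ * Real.log (codeLength i) ≤ 2 ^ i) ∧
      ∀ i, B * (δ * codeLength i / Real.log (codeLength i)) ≤ 2 ^ 2 ^ i := by
  have hB' : (1 : ℝ) ≤ B := by exact_mod_cast hB
  refine ⟨1 / (4096 * B), by positivity, fun i => ?_, fun i => ?_⟩
  · rw [one_div_mul_eq_div, div_le_iff₀ (by positivity)]
    calc Real.log (codeLength i) ≤ 12 * 2 ^ i := log_codeLength_le i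
      _ ≤ 2 ^ i * (4096 * B) := by
        rw [mul_comm]
        gcongr
        linarith
  · calc B * (1 / (4096 * B) * codeLength i / Real.log (codeLength i))
        = 1 / 4096 * (codeLength i / Real.log (codeLength i)) := by field_simp
      _ ≤ 1 / 4096 * (4096 * 2 ^ 2 ^ i) := by
        gcongr
        exact codeLength_div_log_le i
      _ = 2 ^ 2 ^ i := by ring

theorem four_mul_mul_one_sub_le {p : ℝ} (hp : p ≤ 1 / 4) : 4 * p * (1 - p) ≤ 3 / 4 := by
  nlinarith

theorem lt_one_quarter_of_lt {c p : ℝ} (hc : 0 < c) (hp : p < 1 / 4 ^ (c + 1)) : p < 1 / 4 := by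
  refine hp.trans_le (one_div_le_one_div_of_le (by norm_num) ?_)
  exact Real.self_le_rpow_of_one_le (by norm_num) (by linarith)

theorem two_rpow_mul_pow_le_half {c p : ℝ} (hc : 0 < c) (h0 : 0 ≤ p)
    (hp : p < 1 / 4 ^ (c + 1)) :
    (2 : ℝ) ^ (12 * (c + 1)) * (4 * p * (1 - p)) ^ 128 ≤ 1 / 2 := by
  have hp4 := (lt_one_quarter_of_lt hc hp).le
  have hρ0 : 0 ≤ 4 * p * (1 - p) := mul_nonneg (by linarith) (by linarith)
  have hρ := four_mul_mul_one_sub_le hp4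
  have hρc : 4 ^ (c + 1) * (4 * p * (1 - p)) ≤ 4 := by
    rw [lt_div_iff₀ (by positivity)] at hp
    calc (4 : ℝ) ^ (c + 1) * (4 * p * (1 - p)) = 4 * (p * 4 ^ (c + 1)) * (1 - p) := by ring
      _ ≤ 4 * 1 * 1 := by gcongr <;> linarith
      _ = 4 := by norm_num
  generalize 4 * p * (1 - p) = ρ at *
  have hexp : (2 : ℝ) ^ (12 * (c + 1)) = (4 ^ (c + 1)) ^ 6 := by
    rw [← Real.rpow_mul_natCast (by norm_num), show (4 : ℝ) = 2 ^ (2 : ℝ) by norm_num,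
      ← Real.rpow_mul (by norm_num)]
    norm_num
    ring_nf
  calc (2 : ℝ) ^ (12 * (c + 1)) * ρ ^ 128 = (4 ^ (c + 1) * ρ) ^ 6 * ρ ^ 122 := by
        rw [hexp]
        ring
    _ ≤ 4 ^ 6 * (3 / 4) ^ 122 := by gcongr
    _ ≤ 1 / 2 := by norm_num

theorem codeLength_rpow_mul_le {c p : ℝ} (hc : 0 < c) (h0 : 0 ≤ p) (hp : p < 1 / 4 ^ (c + 1))
    (i : ℕ) : (codeLength i : ℝ) ^ c *
      ((4 * 2 ^ 2 ^ i : ℕ) * (4 * p * (1 - p)) ^ 2 ^ (i + 7)) ≤ (1 / 2) ^ i := by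
  have hρ0 : 0 ≤ 4 * p * (1 - p) :=
    mul_nonneg (by linarith) (by linarith [lt_one_quarter_of_lt hc hp])
  have hkey := two_rpow_mul_pow_le_half hc h0 hp
  generalize 4 * p * (1 - p) = ρ at *
  have hN : (0 : ℝ) < codeLength i := by exact_mod_cast two_pos.trans_le (two_le_codeLength i)
  calc (codeLength i : ℝ) ^ c * ((4 * 2 ^ 2 ^ i : ℕ) * ρ ^ 2 ^ (i + 7))
      ≤ (codeLength i : ℝ) ^ c * (codeLength i * ρ ^ 2 ^ (i + 7)) := by
        gcongr
        exact le_codeLength i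
    _ = (codeLength i : ℝ) ^ (c + 1) * (ρ ^ 128) ^ 2 ^ i := by
        rw [Real.rpow_add_one hN.ne', ← pow_mul, pow_add, mul_comm (2 ^ i) (2 ^ 7), mul_assoc]
        norm_num
    _ ≤ ((2 : ℝ) ^ (12 * 2 ^ i)) ^ (c + 1) * (ρ ^ 128) ^ 2 ^ i := by
        gcongr
        exact_mod_cast codeLength_le_two_pow i
    _ = ((2 : ℝ) ^ (12 * (c + 1)) * ρ ^ 128) ^ 2 ^ i := by
        rw [mul_pow, ← Real.rpow_natCast, ← Real.rpow_natCast (_ ^ (12 * (c + 1))),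
          ← Real.rpow_mul (by norm_num), ← Real.rpow_mul (by norm_num)]
        congr 2
        push_cast
        ring
    _ ≤ (1 / 2) ^ 2 ^ i := by gcongr
    _ ≤ (1 / 2) ^ i := pow_le_pow_of_le_one (by norm_num) (by norm_num) Nat.lt_two_pow_self.le

theorem correctsErrors_of_forall_block {Q : ∀ i, CSSCode (codeLength i)}
    {D : ∀ i, (Q i).Syndrome → (Fin (codeLength i) ⊕ Fin (codeLength i) → ZMod 2)} {δ : ℝ}
    (h : ∀ i (u v : Bits (codeLength i)),
      (∀ b : Fin (4 * 2 ^ 2 ^ i), hammingNorm (block u b) ≤ 2 ^ (i + 7)) →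
      (hammingNorm v : ℝ) ≤ δ * codeLength i / Real.log (codeLength i) →
      (Q i).Corrects (D i) u v) :
    CorrectsErrors codeLength Q D δ := by
  refine ⟨fun i v hv => h i 0 v (fun _ => ?_) hv, fun c hc p h0 hp => ?_⟩
  · exact (hammingNorm_zero (β := fun _ => ZMod 2)).trans_le (Nat.zero_le _)
  have hp4 := lt_one_quarter_of_lt hc hp
  refine squeeze_zero (g := fun i => (1 / 2 : ℝ) ^ i)
    (fun i => mul_nonneg (by positivity) (bernoulliProb_nonneg h0 (by linarith) _)) (fun i => ?_)
    (tendsto_pow_atTop_nhds_zero_of_lt_one (by norm_num) (by norm_num))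
  refine le_trans ?_ (codeLength_rpow_mul_le hc h0 hp i)
  gcongr
  refine (bernoulliProb_mono h0 (by linarith) ?_).trans
    (bernoulliProb_exists_block_lt_hammingNorm_le h0 (by linarith))
  rintro u ⟨v, hv, hbad⟩
  by_contra hgood
  exact hbad (h i u v (fun b => not_lt.1 fun hb => hgood ⟨b, hb⟩) hv)

theorem exists_computes_mulVec_eq : ∃ L B : ℕ, 0 < B ∧ ∀ m k, 0 < m → 4 * m < 2 ^ k →
    ∃ (H : Matrix (Fin (2 * m)) (Fin (4 * m)) (ZMod 2)) (φ : Bits (2 * m) → Bits (4 * m)),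
      Computes (4 * m) (L * (k + 1)) φ ∧ ∀ e, B * hammingNorm e ≤ m → φ (H *ᵥ e) = e := by
  obtain ⟨c, hc⟩ : ∃ c, c = 4 * 3 ^ (30 + 1) * 30 ^ 2 * 4 := ⟨_, rfl⟩
  have hc0 : 0 < c := by rw [hc]; positivity
  refine ⟨4 ^ (Fintype.card (Fin (30 + 2)) * (4 * (30 + 2) + 1) + 2), 2 * c, by positivity,
    fun m k hm hk => ?_⟩
  obtain ⟨f, hf, hdeg⟩ := exists_isExpander_card_fiber_le (a := 30) (K := m / c)
    (by norm_num : 0 < 4) hm (hc ▸ Nat.mul_div_le m c)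
  have : NeZero (4 * m) := ⟨by positivity⟩
  refine ⟨tannerMatrix f, flipDecode f k, computes_flipDecode hdeg k, fun e he => ?_⟩
  refine hf.flipDecode_mulVec (by simp) (by simpa using hk) ((Nat.le_div_iff_mul_le hc0).2 ?_)
  linarith

theorem exists_asymmetric_code : ∃ L B : ℕ, 0 < B ∧ ∀ m h k, 0 < m → 4 * m < 2 ^ k →
    ∃ (Q : CSSCode (4 * m * (2 * h + 1)))
      (D : Q.Syndrome → Fin (4 * m * (2 * h + 1)) ⊕ Fin (4 * m * (2 * h + 1)) → ZMod 2),
      Q.rX + Q.rZ ≤ 4 * m * (2 * h + 1) ∧ m ≤ Q.logicalDim ∧ m ≤ B * Q.distZ ∧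
      2 * h + 1 ≤ Q.distX ∧ Computes (4 * m) (1025 * (2 * h + 1) + (L * (k + 1) + 1)) D ∧
      ∀ u v, (∀ b, hammingNorm (block u b) ≤ h) → B * hammingNorm v ≤ m → Q.Corrects D u v := by
  obtain ⟨L, B, hB, hcode⟩ := exists_computes_mulVec_eq
  refine ⟨L, B, hB, fun m h k hm hk => ?_⟩
  obtain ⟨H, φ, hφ, hφH⟩ := hcode m k hm hk
  have hgen : 2 * m + 4 * m * (2 * h) + 2 * m = 4 * m * (2 * h + 1) := by ring
  have hr : 2 * m + 4 * m * (2 * h) < 4 * m * (2 * h + 1) := by omega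
  have hdist : ∀ e, H *ᵥ e = 0 → hammingNorm e < m / B + 1 → e = 0 := fun e he hlt => by
    have hsmall : ∀ e, hammingNorm e ≤ m / B → φ (H *ᵥ e) = e := fun e he =>
      hφH e ((Nat.mul_le_mul_left B he).trans (Nat.mul_div_le m B))
    rw [← hsmall e (Nat.le_of_lt_succ hlt), he, ← Matrix.mulVec_zero H,
      hsmall 0 (hammingNorm_zero.trans_le (Nat.zero_le _))]
  have : NeZero (4 * m) := ⟨by positivity⟩
  refine ⟨concatCode H (2 * h), concatDecode H repetitionDecode φ, hr.le, ?_, ?_,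
    le_distX_concatCode H hr, computes_concatDecode H (computes_repetitionDecode _) hφ,
    fun u v hu hv => ?_⟩
  · have hrank := (concatCode H (2 * h)).le_logicalDim
    change _ ≤ _ + 2 * m + 4 * m * (2 * h) at hrank
    omega
  · exact (Nat.lt_mul_div_succ m hB).le.trans
      (Nat.mul_le_mul_left B (le_distZ_concatCode H hr hdist))
  · refine corrects_concatDecode H
      (fun b => repetitionDecode_eq (Nat.lt_succ_of_le (Nat.mul_le_mul_left 2 (hu b)))) (hφH _ ?_)
    exact (Nat.mul_le_mul_left B (hammingNorm_blockParity_le v)).trans hv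

theorem exists_asymmetric_code_family : ∃ L B : ℕ, 0 < B ∧
    ∃ (Q : ∀ i, CSSCode (codeLength i))
      (D : ∀ i, (Q i).Syndrome → Fin (codeLength i) ⊕ Fin (codeLength i) → ZMod 2),
      (∀ i, (Q i).rX + (Q i).rZ ≤ codeLength i) ∧ (∀ i, 2 ^ 2 ^ i ≤ B * (Q i).logicalDim) ∧
      (∀ i, 2 ^ 2 ^ i ≤ B * (Q i).distZ) ∧ (∀ i, 2 ^ i ≤ (Q i).distX) ∧
      (∀ i, Computes (4 * 2 ^ 2 ^ i) (L * 2 ^ i) (D i)) ∧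
      ∀ i u v, (∀ b : Fin (4 * 2 ^ 2 ^ i), hammingNorm (block u b) ≤ 2 ^ (i + 7)) →
        B * hammingNorm v ≤ 2 ^ 2 ^ i → (Q i).Corrects (D i) u v := by
  obtain ⟨L, B, hB, hcode⟩ := exists_asymmetric_code
  have hrounds : ∀ i : ℕ, 4 * 2 ^ 2 ^ i < 2 ^ (2 ^ i + 3) := fun i => by
    have : 0 < 2 ^ 2 ^ i := by positivity
    rw [pow_add]
    omega
  choose Q D hr hk hZ hX hD hcor using fun i : ℕ =>
    hcode (2 ^ 2 ^ i) (2 ^ (i + 7)) (2 ^ i + 3) (by positivity) (hrounds i)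
  refine ⟨263426 + 5 * L, B, hB, Q, D, hr, fun i => (hk i).trans (Nat.le_mul_of_pos_left _ hB), hZ,
    fun i => le_trans ?_ (hX i), fun i => (hD i).mono ?_, hcor⟩
  · have : 2 ^ i ≤ 2 ^ (i + 7) := Nat.pow_le_pow_right two_pos (by omega)
    omega
  · have hone : 1 ≤ 2 ^ i := Nat.one_le_two_pow
    have hL := Nat.mul_le_mul_left L hone
    rw [pow_add]
    nlinarith

theorem corollary3 :
    ∃ (N : ℕ → ℕ) (Q : ∀ i, CSSCode (N i)) (k : ℕ → ℕ) (δ C : ℝ),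
      StrictMono N ∧ (∀ i, 2 ≤ N i) ∧ 0 < δ ∧ 0 < C ∧
      -- at most `N` stabilizer generators are measured
      (∀ i, (Q i).rX + (Q i).rZ ≤ N i) ∧
      -- the parameters `[[N, Ω(N / log N), Ω(N / log N) / Ω(log N)]]`
      (∀ i, Module.finrank ℂ (Q i).codeSpace = 2 ^ k i) ∧
      (∀ i, δ * N i / Real.log (N i) ≤ k i) ∧
      (∀ i, δ * N i / Real.log (N i) ≤ (Q i).distZ) ∧
      (∀ i, δ * Real.log (N i) ≤ (Q i).distX) ∧
      -- sequential decoding in time `O(N)`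
      (∃ (T : ℕ → ℕ) (A : ∀ i, Decoder (Q i) 1 (T i)),
        (∀ i, (T i : ℝ) ≤ C * N i) ∧
        CorrectsErrors N Q (fun i => (A i).eval) δ) ∧
      -- parallel decoding in time `O(log N)` on `O(N)` processors
      (∃ (P T : ℕ → ℕ) (A : ∀ i, Decoder (Q i) (P i) (T i)),
        (∀ i, (P i : ℝ) ≤ C * N i) ∧ (∀ i, (T i : ℝ) ≤ C * Real.log (N i)) ∧
        CorrectsErrors N Q (fun i => (A i).eval) δ) := by
  obtain ⟨L, B, hB, Q, D, hr, hk, hZ, hX, hD, hcor⟩ := exists_asymmetric_code_family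
  obtain ⟨δ, hδ, hδX, hδZ⟩ := exists_pos_mul_codeLength_div_log_le hB
  have hB' : (0 : ℝ) < B := by exact_mod_cast hB
  have hle {i d} (hd : 2 ^ 2 ^ i ≤ B * d) : δ * codeLength i / Real.log (codeLength i) ≤ d :=
    le_of_mul_le_mul_left ((hδZ i).trans (by exact_mod_cast hd)) hB'
  have hcorrects : CorrectsErrors codeLength Q D δ := correctsErrors_of_forall_block
    fun i u v hu hv => hcor i u v hu <| by
      exact_mod_cast (mul_le_mul_of_nonneg_left hv hB'.le).trans (hδZ i)
  choose A hA using hD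
  choose A' hA' using fun i => Computes.sequential ⟨A i, hA i⟩
  have hAD : (fun i => (A i).eval) = D := funext fun i => funext (hA i)
  have hAD' : (fun i => (A' i).eval) = D := funext fun i => funext (hA' i)
  refine ⟨codeLength, Q, fun i => (Q i).logicalDim, δ, 2 * L + 1, codeLength_strictMono,
    two_le_codeLength, hδ, by positivity, hr, fun i => (Q i).finrank_codeSpace,
    fun i => hle (hk i), fun i => hle (hZ i), fun i => (hδX i).trans (by exact_mod_cast hX i),
    ⟨_, A', fun i => ?_, hAD' ▸ hcorrects⟩, ⟨_, _, A, fun i => ?_, fun i => ?_, hAD ▸ hcorrects⟩⟩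
  · rw [mul_assoc L]
    exact_mod_cast Nat.mul_le_mul (by omega : L ≤ 2 * L + 1) (two_pow_mul_le_codeLength i)
  · exact_mod_cast (le_codeLength i).trans (Nat.le_mul_of_pos_left _ (Nat.succ_pos (2 * L)))
  · have hlog := two_pow_le_log_codeLength i
    push_cast
    nlinarith [mul_le_mul_of_nonneg_left hlog L.cast_nonneg, pow_pos (two_pos (α := ℝ)) i]
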